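/- **Conventions.** A *collared disc* in a space $X$ is an open embedding $e:\mathbb R^4\to X$; the disc itself is $e(D)$, where $D=\{\|v\|\le 1\}$, and its centre is $e(0)$. Let $e,f$ be collared discs in $X,Y$. The connected sum $X\# Y$ along $e,f$ is obtained from $X\setminus e(\operatorname{int}D)$ and $Y\setminus f(\operatorname{int} D)$ by identifying $e(v)$ with $f(v)$ for $\|v\|=1$. The *smash map* $X\# Y\to X\vee Y$, where the wedge identifies $e(0)$ with $f(0)$, sends $e(v)$ (respectively $f(v)$) to $e\big(2(\|v\|-1)v/\|v\|\big)$ (respectively $f\big(2(\|v\|-1)v/\|v\|\big)$) for $1\le\|v\|\le 2$, and is the identity elsewhere. So it collapses the common boundary sphere to the base point and stretches its bicollar radially. A continuous map $p:X\to B$ to a metric space is $UV^1(\delta)$ if, for every CW complex $K$ of dimension at most $2$, every subcomplex $K_0\subset K$ and all continuous $\alpha_0:K_0\to X$, $\alpha:K\to B$ with $p\circ\alpha_0=\alpha|_{K_0}$, there is a continuous $\bar\alpha:K\to X$ with $\bar\alpha|_{K_0}=\alpha_0$ and $d(p(\bar\alpha(u)),\alpha(u))<\delta$ for all $u\in K$.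 If $B$ is compact and metrizable, $p$ is $UV^1$ if it is $UV^1(\delta)$ for every $\delta>0$ and every metric inducing the topology of $B$. For $r\ge1$ the connected sum $P_r=\#_r\,(S^1\times S^3)$ is formed by adding one summand at a time, together with a map $q_r:P_r\to W_r=\bigvee_r (S^1\times S^3)$. One starts with $P_1=W_1=S^1\times S^3$ with any base point and $q_1=\mathrm{id}$. Given $P_k$ and $q_k$, choose any collared disc in $P_k$ whose centre is sent to the base point by $q_k$, and any collared disc in $S^1\times S^3$. Then $P_{k+1}=P_k\#(S^1\times S^3)$, $W_{k+1}=W_k\vee(S^1\times S^3)$ with the same base point, and $q_{k+1}$ is the smash map $P_{k+1}\to P_k\vee (S^1\times S^3)$ followed by $q_k\vee\mathrm{id}$. **Corollary 3.4.** Let $r\ge 1$, let $P_r=\#_r\,(S^1\times S^3)$ and $q_r$ be formed as above, and let $M'$ be a simply connected topological $4$-manifold. Form $M=P_r\# M'$ along any collared discs in $P_r$ and $M'$. Let $p=p_3\circ p_2\circ p_1$ be the composition $$M=\Big(\#_r\,S^1\times S^3\Big)\# M'\xrightarrow{\;p_1\;}\Big(\bigvee_r S^1\times S^3\Big)\vee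 M'\xrightarrow{\;p_2\;}\bigvee_r S^1\times S^3\xrightarrow{\;p_3\;}\bigvee_r S^1=B ,$$ where $p_1$ is the smash map $P_r\#M'\to P_r\vee M'$ followed by $q_r\vee\mathrm{id}_{M'}$, $p_2$ collapses $M'$ to the point at which it is attached, and $p_3$ is induced by the projections $S^1\times S^3\to S^1$. Then $B$ is compact and metrizable, and $p$ is a $UV^1$ map. -/

import Mathlib

open Topology

universe w u v

/-! ### `UV¹` maps -/

/-- A map `p : X → B` to a metric space is `UV¹(δ)` if every commutative square
```
  K₀ --α₀--> X
  |          | p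
  K  --α --> B
```
with `K` a 2-complex (a CW complex without cells of dimension greater than two) and `K₀` a
subcomplex admits a continuous `β : K → X` extending `α₀` with `d (p (β u)) (α u) < δ` for
all `u`. -/
def IsUV1Delta {X : Type u} {B : Type v} [TopologicalSpace X] [MetricSpace B]
    (δ : ℝ) (p : X → B) : Prop :=
  ∀ (K : Type w) [TopologicalSpace K] [T2Space K] [CWComplex (Set.univ : Set K)],
    (∀ n : ℕ, 2 < n → IsEmpty (RelCWComplex.cell (Set.univ : Set K) n)) →
    ∀ (K₀ : RelCWComplex.Subcomplex (Set.univ : Set K))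
      (α₀ : C((K₀ : Set K), X)) (α : C(K, B)),
      (∀ u : (K₀ : Set K), p (α₀ u) = α u) →
      ∃ β : C(K, X), (∀ u : (K₀ : Set K), β u = α₀ u) ∧ ∀ u : K, dist (p (β u)) (α u) < δ

/-- A continuous map to a (metrizable) space `B` is `UV¹` if it is `UV¹(δ)` for every `δ > 0`,
with respect to every metric that induces the topology of `B`. -/
def IsUV1 {X : Type u} {B : Type v} [TopologicalSpace X] [tB : TopologicalSpace B]
    (p : X → B) : Prop :=
  Continuous p ∧
    ∀ m : MetricSpace B, m.toPseudoMetricSpace.toUniformSpace.toTopologicalSpace = tB →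
      ∀ δ : ℝ, 0 < δ → IsUV1Delta.{w, u, v} δ p

/-! ### Wedges -/

/-- The relation identifying `x₀ : X` with `y₀ : Y`. -/
inductive WedgeRel {X : Type*} {Y : Type*} (x₀ : X) (y₀ : Y) : X ⊕ Y → X ⊕ Y → Prop
  | base : WedgeRel x₀ y₀ (Sum.inl x₀) (Sum.inr y₀)

/-- The wedge `(X, x₀) ∨ (Y, y₀)`. -/
def Wedge {X : Type*} {Y : Type*} (x₀ : X) (y₀ : Y) : Type _ :=
  Quot (WedgeRel x₀ y₀)

instance {X : Type*} {Y : Type*} [TopologicalSpace X] [TopologicalSpace Y] (x₀ : X) (y₀ : Y) :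
    TopologicalSpace (Wedge x₀ y₀) :=
  inferInstanceAs (TopologicalSpace (Quot (WedgeRel x₀ y₀)))

namespace Wedge

variable {X X' Y Y' : Type*} {x₀ : X} {x₀' : X'} {y₀ : Y} {y₀' : Y'}

/-- Inclusion of the first summand. -/
def inl (x₀ : X) (y₀ : Y) (x : X) : Wedge x₀ y₀ := Quot.mk _ (Sum.inl x)

/-- Inclusion of the second summand. -/
def inr (x₀ : X) (y₀ : Y) (y : Y) : Wedge x₀ y₀ := Quot.mk _ (Sum.inr y)

theorem glue (x₀ : X) (y₀ : Y) : inl x₀ y₀ x₀ = inr x₀ y₀ y₀ := Quot.sound WedgeRel.base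

/-- The wedge `f ∨ g` of two base point preserving maps. -/
def map (f : X → X') (g : Y → Y') (hf : f x₀ = x₀') (hg : g y₀ = y₀') :
    Wedge x₀ y₀ → Wedge x₀' y₀' :=
  Quot.lift (Sum.elim (fun x => inl x₀' y₀' (f x)) (fun y => inr x₀' y₀' (g y))) (by
    rintro _ _ ⟨⟩
    simp only [Sum.elim_inl, Sum.elim_inr, hf, hg]
    exact glue _ _)

/-- The projection `X ∨ Y → X`, which collapses `Y` to the base point. -/
def collapseRight : Wedge x₀ y₀ → X :=
  Quot.lift (Sum.elim id (fun _ => x₀)) (by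
    rintro _ _ ⟨⟩
    rfl)

end Wedge

/-! ### Connected sums of 4-dimensional manifolds and the smash map -/

/-- Four-dimensional Euclidean space. -/
abbrev E4 : Type := EuclideanSpace ℝ (Fin 4)

/-- A collared disc in `X`: an open embedding of `ℝ⁴`. The disc itself is the image of the
closed unit ball. -/
structure CollaredDisc (X : Type*) [TopologicalSpace X] where
  /-- The embedding. -/
  toFun : E4 → X
  isOpenEmbedding : IsOpenEmbedding toFun

namespace CollaredDisc

variable {X : Type*} {Y : Type*} [TopologicalSpace X] [TopologicalSpace Y]

/-- The centre of a disc. -/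
def center (e : CollaredDisc X) : X := e.toFun 0

/-- `X` with the interior of the disc removed. -/
def Exterior (e : CollaredDisc X) : Type _ :=
  {x : X // x ∉ e.toFun '' Metric.ball 0 1}

instance (e : CollaredDisc X) : TopologicalSpace e.Exterior :=
  inferInstanceAs (TopologicalSpace {x : X // x ∉ e.toFun '' Metric.ball 0 1})

/-- The radial self-map of `ℝ⁴` that sends the closed unit ball to the origin, stretches the
spherical shell `1 ≤ ‖v‖ ≤ 2` linearly in the radius onto the ball of radius `2`, and fixes the
sphere of radius `2`. -/
noncomputable def radial (v : E4) : E4 := (2 * max (‖v‖ - 1) 0 / ‖v‖) • v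

open Classical in
/-- The self-map of `X` that is `radial` on the image of the closed ball of radius `2` and the
identity elsewhere. It sends the disc to its centre. -/
noncomputable def squeeze (e : CollaredDisc X) (x : X) : X :=
  if h : ∃ v : E4, ‖v‖ ≤ 2 ∧ e.toFun v = x then e.toFun (radial h.choose) else x

theorem squeeze_of_norm_eq_one (e : CollaredDisc X) {v : E4} (hv : ‖v‖ = 1) :
    e.squeeze (e.toFun v) = e.center := by
  have h : ∃ w : E4, ‖w‖ ≤ 2 ∧ e.toFun w = e.toFun v := ⟨v, by rw [hv]; norm_num, rfl⟩
  have hw : h.choose = v := e.isOpenEmbedding.injective h.choose_spec.2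
  rw [squeeze, dif_pos h, hw, center, radial, hv]
  simp

/-- The relation identifying the boundary points `e v` and `f v` of two discs, `‖v‖ = 1`. -/
inductive GlueRel (e : CollaredDisc X) (f : CollaredDisc Y) :
    e.Exterior ⊕ f.Exterior → e.Exterior ⊕ f.Exterior → Prop
  | glue (a : e.Exterior) (b : f.Exterior) (v : E4) (hv : ‖v‖ = 1)
      (ha : a.1 = e.toFun v) (hb : b.1 = f.toFun v) : GlueRel e f (Sum.inl a) (Sum.inr b)

end CollaredDisc

/-- The connected sum `X # Y` along the discs `e` and `f`: the interiors of the discs are removed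
and their boundary 3-spheres are identified. -/
def ConnSum {X : Type*} {Y : Type*} [TopologicalSpace X] [TopologicalSpace Y]
    (e : CollaredDisc X) (f : CollaredDisc Y) : Type _ :=
  Quot (CollaredDisc.GlueRel e f)

instance {X : Type*} {Y : Type*} [TopologicalSpace X] [TopologicalSpace Y]
    (e : CollaredDisc X) (f : CollaredDisc Y) : TopologicalSpace (ConnSum e f) :=
  inferInstanceAs (TopologicalSpace (Quot (CollaredDisc.GlueRel e f)))

/-- The smash map `X # Y → X ∨ Y`. It sends the common boundary sphere of the two discs to the
base point, smashes its bicollar radially onto the two discs of radius `2`, and is the identity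
outside the bicollar. The base points of the wedge are the centres of the discs. -/
noncomputable def ConnSum.smash {X : Type*} {Y : Type*} [TopologicalSpace X] [TopologicalSpace Y]
    (e : CollaredDisc X) (f : CollaredDisc Y) : ConnSum e f → Wedge e.center f.center :=
  Quot.lift
    (Sum.elim (fun a : e.Exterior => Wedge.inl e.center f.center (e.squeeze a.1))
      (fun b : f.Exterior => Wedge.inr e.center f.center (f.squeeze b.1))) (by
    rintro _ _ ⟨a, b, v, hv, ha, hb⟩
    simp only [Sum.elim_inl, Sum.elim_inr, ha, hb, CollaredDisc.squeeze_of_norm_eq_one _ hv]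
    exact Wedge.glue _ _)

/-! ### The sum of `r` copies of `S¹ × S³`, with its maps to the wedges -/

/-- The manifold `S¹ × S³`. -/
abbrev S1xS3 : Type := Circle × Metric.sphere (0 : E4) 1

/-- Spaces and maps `sum → wedge → circles`. The objects of interest are those that are built by
`SumTower.one` and `SumTower.succ` below, where `sum` is `S¹ × S³ # ⋯ # S¹ × S³`, `wedge` is
`S¹ × S³ ∨ ⋯ ∨ S¹ × S³` and `circles` is `S¹ ∨ ⋯ ∨ S¹`. -/
structure SumTower where
  /-- The connected sum. -/
  sum : Type
  /-- The wedge of the summands. -/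
  wedge : Type
  /-- The wedge of the circles. -/
  circles : Type
  topSum : TopologicalSpace sum
  topWedge : TopologicalSpace wedge
  topCircles : TopologicalSpace circles
  /-- The base point of `wedge`. -/
  base : wedge
  /-- The iterated smash map. -/
  smash : sum → wedge
  /-- The map induced by the projections `S¹ × S³ → S¹`. Its value at `base` is the base point of
  `circles`. -/
  proj : wedge → circles

namespace SumTower

attribute [instance] topSum topWedge topCircles

/-- One summand: `S¹ × S³` with base point `x`, the identity, and the projection to `S¹`. -/
noncomputable def one (x : S1xS3) : SumTower where
  sum := S1xS3
  wedge := S1xS3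
  circles := Circle
  topSum := inferInstance
  topWedge := inferInstance
  topCircles := inferInstance
  base := x
  smash := id
  proj := Prod.fst

/-- One more summand. The disc `e` is centred at a point that the smash map `P → W` of `S` sends to
the base point (so for two or more summands its centre lies on a 3-sphere along which the summands
have been joined). Hence `P # (S¹ × S³) → P ∨ (S¹ × S³)` can be followed by the map
`P ∨ (S¹ × S³) → W ∨ (S¹ × S³)`, and all summands of the wedge share one base point. -/
noncomputable def succ (S : SumTower) (e : CollaredDisc S.sum) (he : S.smash e.center = S.base)
    (f : CollaredDisc S1xS3) : SumTower where
  sum := ConnSum e f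
  wedge := Wedge S.base f.center
  circles := Wedge (S.proj S.base) f.center.1
  topSum := inferInstance
  topWedge := inferInstance
  topCircles := inferInstance
  base := Wedge.inl S.base f.center S.base
  smash := fun z => Wedge.map S.smash id he rfl (ConnSum.smash e f z)
  proj := Wedge.map S.proj Prod.fst rfl rfl

/-- `S` is built from `r` copies of `S¹ × S³`. -/
inductive IsSumOf : ℕ → SumTower → Prop
  | one (x : S1xS3) : IsSumOf 1 (SumTower.one x)
  | succ {r : ℕ} {S : SumTower} (hS : IsSumOf r S) (e : CollaredDisc S.sum)
      (he : S.smash e.center = S.base) (f : CollaredDisc S1xS3) :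
      IsSumOf (r + 1) (S.succ e he f)

variable (S : SumTower) {M' : Type*} [TopologicalSpace M']

/-- `p₁ : (# S¹ × S³) # M' → (∨ S¹ × S³) ∨ M'`, the smash map. The manifold `M'` may be attached
anywhere. -/
noncomputable def p₁ (e : CollaredDisc S.sum) (f : CollaredDisc M') :
    ConnSum e f → Wedge (S.smash e.center) f.center :=
  fun z => Wedge.map S.smash id rfl rfl (ConnSum.smash e f z)

/-- `p₂ : (∨ S¹ × S³) ∨ M' → ∨ S¹ × S³`, the collapse of `M'`. -/
def p₂ (e : CollaredDisc S.sum) (f : CollaredDisc M') :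
    Wedge (S.smash e.center) f.center → S.wedge :=
  Wedge.collapseRight

/-- `p₃ : ∨ S¹ × S³ → ∨ S¹`, induced by the projections `S¹ × S³ → S¹`. -/
def p₃ : S.wedge → S.circles := S.proj

/-- The control map `p = p₃ ∘ p₂ ∘ p₁ : (# S¹ × S³) # M' → ∨ S¹`. -/
noncomputable def controlMap (e : CollaredDisc S.sum) (f : CollaredDisc M') :
    ConnSum e f → S.circles :=
  S.p₃ ∘ S.p₂ e f ∘ S.p₁ e f

end SumTower

open Set Filter

/-! A map to a compact metrizable space is `UV¹` as soon as every point has arbitrarily small open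
neighbourhoods whose preimages are path connected and simply connected
(`isUV1_of_oneConnectedOver`). Compactness makes these neighbourhoods uniform in size. A cell is
subdivided until the map to be lifted hardly varies on each piece; vertices, edges and squares are
then placed in preimages at three increasing scales. Induction over the skeleta, with tolerances
chosen backwards from dimension two, lifts the whole complex.

The topological input is that preimages of small sets under the control map are 1-connected. Embed
the wedge of two targets in their product; the map of a connected sum then becomes the pair of the
two collapses followed by the maps of the summands (`ConnSum.oneConnectedOver_prod`). Away from the
wedge point a small preimage lies in one summand and nothing changes. At the wedge point the
preimage is a connected sum of 1-connected open sets: two punctured sets joined by the bicollar, a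
thickened 3-sphere (`ConnSum.oneConnected_preimage`). Puncturing does no harm because a punctured
4-ball is 1-connected (`OneConnected.diff_singleton`), and van Kampen applies twice
(`OneConnected.union`).

The induction over the summands starts from a short arc in the circle, whose preimage is an arc
times `S³`. The manifold `M'` enters as one more summand, mapped to a point, and only its simple
connectivity matters.

Simple connectivity is recorded as the filling of boundaries of squares, the form in which lifting
consumes it. One extension lemma over planar grids, `exists_grid_extension`, then serves van Kampen,
the removal of points and approximate lifting. -/

/-! ### Path connectedness and filling of squares -/

/-- The unit square. -/
def unitSq : Set (ℝ × ℝ) := Icc 0 1 ×ˢ Icc 0 1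

/-- The boundary of the unit square. -/
def unitSqBd : Set (ℝ × ℝ) := {p ∈ unitSq | p.1 = 0 ∨ p.1 = 1 ∨ p.2 = 0 ∨ p.2 = 1}

theorem unitSqBd_subset : unitSqBd ⊆ unitSq := fun _ h => h.1

theorem isCompact_unitSq : IsCompact unitSq := isCompact_Icc.prod isCompact_Icc

theorem isClosed_unitSq : IsClosed unitSq := isCompact_unitSq.isClosed

theorem isClosed_unitSqBd : IsClosed unitSqBd := by
  have : unitSqBd = unitSq ∩ ({p | p.1 = 0} ∪ ({p | p.1 = 1} ∪ ({p | p.2 = 0} ∪ {p | p.2 = 1}))) := by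
    ext p; simp [unitSqBd, and_or_left]
  rw [this]
  refine isClosed_unitSq.inter ((isClosed_eq ?_ ?_).union ((isClosed_eq ?_ ?_).union
    ((isClosed_eq ?_ ?_).union (isClosed_eq ?_ ?_)))) <;> fun_prop

/-- Every map of the boundary of the unit square to `S` extends to a map of the square to `S`. -/
def SquareFills {Z : Type*} [TopologicalSpace Z] (S : Set Z) : Prop :=
  ∀ g : ℝ × ℝ → Z, ContinuousOn g unitSqBd → MapsTo g unitSqBd S →
    ∃ G : ℝ × ℝ → Z, ContinuousOn G unitSq ∧ MapsTo G unitSq S ∧ EqOn G g unitSqBd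

/-- A set that is path connected and in which boundaries of squares can be filled. -/
structure OneConnected {Z : Type*} [TopologicalSpace Z] (S : Set Z) : Prop where
  pathConnected : IsPathConnected S
  fills : SquareFills S

theorem IsPathConnected.exists_fun {Z : Type*} [TopologicalSpace Z] {S : Set Z}
    (hS : IsPathConnected S) {a b : Z} (ha : a ∈ S) (hb : b ∈ S) {s t : ℝ} (hst : s < t) :
    ∃ γ : ℝ → Z, Continuous γ ∧ (∀ x, γ x ∈ S) ∧ γ s = a ∧ γ t = b := by
  obtain ⟨p, hp⟩ := hS.joinedIn a ha b hb
  refine ⟨fun x => p.extend ((x - s) / (t - s)), ?_, fun x => ?_, ?_, ?_⟩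
  · exact p.continuous_extend.comp (by fun_prop)
  · have : p.extend ((x - s) / (t - s)) ∈ range p.extend := mem_range_self _
    rw [Path.extend_range] at this
    obtain ⟨y, hy⟩ := this
    exact Set.mem_of_eq_of_mem hy.symm (hp y)
  · simp
  · have : (t - s) / (t - s) = 1 := div_self (by linarith)
    simp [this]

/-- Filling of a rectangle whose four sides are given. -/
theorem SquareFills.exists_fill {Z : Type*} [TopologicalSpace Z] {S : Set Z} (hS : SquareFills S)
    {a a' b b' : ℝ} (ha : a < a') (hb : b < b') {bot top lft rgt : ℝ → Z}
    (cbot : ContinuousOn bot (Icc a a')) (ctop : ContinuousOn top (Icc a a'))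
    (clft : ContinuousOn lft (Icc b b')) (crgt : ContinuousOn rgt (Icc b b'))
    (mbot : MapsTo bot (Icc a a') S) (mtop : MapsTo top (Icc a a') S)
    (mlft : MapsTo lft (Icc b b') S) (mrgt : MapsTo rgt (Icc b b') S)
    (e1 : bot a = lft b) (e2 : bot a' = rgt b) (e3 : top a = lft b') (e4 : top a' = rgt b') :
    ∃ Φ : ℝ × ℝ → Z, ContinuousOn Φ (Icc a a' ×ˢ Icc b b') ∧ MapsTo Φ (Icc a a' ×ˢ Icc b b') S ∧
      (∀ x ∈ Icc a a', Φ (x, b) = bot x) ∧ (∀ x ∈ Icc a a', Φ (x, b') = top x) ∧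
      (∀ y ∈ Icc b b', Φ (a, y) = lft y) ∧ (∀ y ∈ Icc b b', Φ (a', y) = rgt y) := by
  classical
  set X : ℝ → ℝ := fun s => a + s * (a' - a) with hX
  set Y : ℝ → ℝ := fun s => b + s * (b' - b) with hY
  have hXm : ∀ s ∈ Icc (0:ℝ) 1, X s ∈ Icc a a' := by
    intro s hs
    constructor <;> simp only [hX] <;> nlinarith [hs.1, hs.2]
  have hYm : ∀ s ∈ Icc (0:ℝ) 1, Y s ∈ Icc b b' := by
    intro s hs
    constructor <;> simp only [hY] <;> nlinarith [hs.1, hs.2]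
  have cX : Continuous X := by fun_prop
  have cY : Continuous Y := by fun_prop
  have X0 : X 0 = a := by simp [hX]
  have X1 : X 1 = a' := by simp [hX]
  have Y0 : Y 0 = b := by simp [hY]
  have Y1 : Y 1 = b' := by simp [hY]
  -- Horizontal sides take precedence at the corners; the four corner equations make the formulas
  -- for the vertical sides valid there too.
  let g : ℝ × ℝ → Z := fun p => if p.2 = 0 then bot (X p.1) else if p.2 = 1 then top (X p.1) else
    if p.1 = 0 then lft (Y p.2) else rgt (Y p.2)
  have g1 : ∀ x, g (x, 0) = bot (X x) := fun x => by simp [g]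
  have g2 : ∀ x, g (x, 1) = top (X x) := fun x => by simp [g]
  have g3 : ∀ y, g (0, y) = lft (Y y) := fun y => by
    simp only [g]
    split_ifs with h1 h2
    · rw [h1, X0, Y0, e1]
    · rw [h2, X0, Y1, e3]
    · rfl
  have g4 : ∀ y, g (1, y) = rgt (Y y) := fun y => by
    simp only [g]
    split_ifs with h1 h2
    · rw [h1, X1, Y0, e2]
    · rw [h2, X1, Y1, e4]
    · simp_all
    · rfl
  have hsub : unitSqBd ⊆ ((Icc 0 1 ×ˢ {0} ∪ Icc 0 1 ×ˢ {1}) ∪ ({0} ×ˢ Icc 0 1 ∪ {1} ×ˢ Icc 0 1)) := by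
    rintro ⟨x, y⟩ ⟨⟨hx, hy⟩, h⟩
    simp only at hx hy h
    rcases h with h | h | h | h <;> subst h <;> simp [hx, hy]
  have hg : ContinuousOn g unitSqBd := by
    refine ContinuousOn.mono ?_ hsub
    refine ContinuousOn.union_of_isClosed (ContinuousOn.union_of_isClosed ?_ ?_ ?_ ?_)
      (ContinuousOn.union_of_isClosed ?_ ?_ ?_ ?_) ?_ ?_
    · refine ContinuousOn.congr (f := fun p => bot (X p.1))
        (cbot.comp (by fun_prop) fun p hp => hXm _ hp.1) ?_
      rintro ⟨x, y⟩ ⟨hx, hy⟩; simp only [mem_singleton_iff] at hy; subst hy; exact g1 x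
    · refine ContinuousOn.congr (f := fun p => top (X p.1))
        (ctop.comp (by fun_prop) fun p hp => hXm _ hp.1) ?_
      rintro ⟨x, y⟩ ⟨hx, hy⟩; simp only [mem_singleton_iff] at hy; subst hy; exact g2 x
    · exact isClosed_Icc.prod isClosed_singleton
    · exact isClosed_Icc.prod isClosed_singleton
    · refine ContinuousOn.congr (f := fun p => lft (Y p.2))
        (clft.comp (by fun_prop) fun p hp => hYm _ hp.2) ?_
      rintro ⟨x, y⟩ ⟨hx, hy⟩; simp only [mem_singleton_iff] at hx; subst hx; exact g3 y
    · refine ContinuousOn.congr (f := fun p => rgt (Y p.2))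
        (crgt.comp (by fun_prop) fun p hp => hYm _ hp.2) ?_
      rintro ⟨x, y⟩ ⟨hx, hy⟩; simp only [mem_singleton_iff] at hx; subst hx; exact g4 y
    · exact isClosed_singleton.prod isClosed_Icc
    · exact isClosed_singleton.prod isClosed_Icc
    · exact (isClosed_Icc.prod isClosed_singleton).union (isClosed_Icc.prod isClosed_singleton)
    · exact (isClosed_singleton.prod isClosed_Icc).union (isClosed_singleton.prod isClosed_Icc)
  have hgm : MapsTo g unitSqBd S := by
    rintro ⟨x, y⟩ ⟨⟨hx, hy⟩, h⟩
    simp only at hx hy h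
    rcases h with h | h | h | h <;> subst h
    · rw [g3]; exact mlft (hYm _ hy)
    · rw [g4]; exact mrgt (hYm _ hy)
    · rw [g1]; exact mbot (hXm _ hx)
    · rw [g2]; exact mtop (hXm _ hx)
  obtain ⟨G, cG, mG, eG⟩ := hS g hg hgm
  have da : 0 < a' - a := by linarith
  have db : 0 < b' - b := by linarith
  have mx : ∀ x ∈ Icc a a', (x - a) / (a' - a) ∈ Icc (0:ℝ) 1 := fun x hx =>
    ⟨div_nonneg (by linarith [hx.1]) da.le, (div_le_one da).2 (by linarith [hx.2])⟩
  have my : ∀ x ∈ Icc b b', (x - b) / (b' - b) ∈ Icc (0:ℝ) 1 := fun x hx =>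
    ⟨div_nonneg (by linarith [hx.1]) db.le, (div_le_one db).2 (by linarith [hx.2])⟩
  have mm : MapsTo (fun p : ℝ × ℝ => ((p.1 - a) / (a' - a), (p.2 - b) / (b' - b)))
      (Icc a a' ×ˢ Icc b b') unitSq := fun p hp => ⟨mx _ hp.1, my _ hp.2⟩
  have hXi : ∀ x, X ((x - a) / (a' - a)) = x := fun x => by simp only [hX]; field_simp; ring
  have hYi : ∀ x, Y ((x - b) / (b' - b)) = x := fun x => by simp only [hY]; field_simp; ring
  have z0 : (0:ℝ) ∈ Icc (0:ℝ) 1 := by simp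
  have z1 : (1:ℝ) ∈ Icc (0:ℝ) 1 := by simp
  refine ⟨fun p => G ((p.1 - a) / (a' - a), (p.2 - b) / (b' - b)),
    cG.comp (by fun_prop) mm, mG.comp mm, fun x hx => ?_, fun x hx => ?_, fun x hx => ?_,
    fun x hx => ?_⟩
  · simp only [sub_self, zero_div]
    rw [eG ⟨⟨mx x hx, z0⟩, by simp⟩, g1, hXi]
  · simp only [div_self db.ne']
    rw [eG ⟨⟨mx x hx, z1⟩, by simp⟩, g2, hXi]
  · simp only [sub_self, zero_div]
    rw [eG ⟨⟨z0, my x hx⟩, by simp⟩, g3, hYi]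
  · simp only [div_self da.ne']
    rw [eG ⟨⟨z1, my x hx⟩, by simp⟩, g4, hYi]

/-! ### Grids in the plane -/

/-- The interval number `i` of mesh `h`. -/
def gridIcc (h : ℝ) (i : ℤ) : Set ℝ := Icc ((i : ℝ) * h) (((i + 1 : ℤ) : ℝ) * h)

/-- A vertex of the grid of mesh `h`. -/
def gridPt (h : ℝ) (i j : ℤ) : ℝ × ℝ := ((i : ℝ) * h, (j : ℝ) * h)

/-- A horizontal edge of the grid of mesh `h`. -/
def gridH (h : ℝ) (i j : ℤ) : Set (ℝ × ℝ) := gridIcc h i ×ˢ {(j : ℝ) * h}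

/-- A vertical edge of the grid of mesh `h`. -/
def gridW (h : ℝ) (i j : ℤ) : Set (ℝ × ℝ) := {(i : ℝ) * h} ×ˢ gridIcc h j

/-- A square of the grid of mesh `h`. -/
def gridQ (h : ℝ) (i j : ℤ) : Set (ℝ × ℝ) := gridIcc h i ×ˢ gridIcc h j

section grid

variable {h : ℝ}

theorem left_mem_gridIcc (hh : 0 < h) (i : ℤ) : (i : ℝ) * h ∈ gridIcc h i := by
  refine ⟨le_rfl, ?_⟩
  push_cast; nlinarith

theorem right_mem_gridIcc (hh : 0 < h) (i : ℤ) : ((i + 1 : ℤ) : ℝ) * h ∈ gridIcc h i := by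
  refine ⟨?_, le_rfl⟩
  push_cast; nlinarith

theorem grid_lt (hh : 0 < h) (i : ℤ) : (i : ℝ) * h < ((i + 1 : ℤ) : ℝ) * h := by
  push_cast; nlinarith

theorem mem_gridIcc_floor (hh : 0 < h) (x : ℝ) : x ∈ gridIcc h ⌊x / h⌋ := by
  constructor
  · exact (le_div_iff₀ hh).1 (Int.floor_le _)
  · have := (div_lt_iff₀ hh).1 (Int.lt_floor_add_one (x / h))
    push_cast; exact this.le

/-- The right endpoint is the only place where the floor selects the neighbouring interval, so a
gluing indexed by floors needs agreement only there. -/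
theorem floor_of_mem_gridIcc (hh : 0 < h) {x : ℝ} {i : ℤ} (hx : x ∈ gridIcc h i) :
    ⌊x / h⌋ = i ∨ (⌊x / h⌋ = i + 1 ∧ x = ((i + 1 : ℤ) : ℝ) * h) := by
  rcases hx.2.eq_or_lt with h1 | h1
  · right
    refine ⟨?_, h1⟩
    rw [h1, mul_div_assoc, div_self hh.ne', mul_one, Int.floor_intCast]
  · left
    rw [Int.floor_eq_iff]
    refine ⟨(le_div_iff₀ hh).2 hx.1, (div_lt_iff₀ hh).2 ?_⟩
    push_cast at h1; exact h1

theorem isClosed_gridQ (i j : ℤ) : IsClosed (gridQ h i j) := isClosed_Icc.prod isClosed_Icc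

theorem locallyFinite_gridIcc (hh : 0 < h) : LocallyFinite (gridIcc h) := by
  refine locallyFinite_Icc_of_tendsto (tendsto_intCast_atTop_atTop.atTop_mul_const hh) ?_
  exact (tendsto_intCast_atBot_iff.2
    (tendsto_atBot_add_const_right _ 1 tendsto_id)).atBot_mul_const hh

theorem locallyFinite_gridQ (hh : 0 < h) :
    LocallyFinite (fun ij : ℤ × ℤ => gridQ h ij.1 ij.2) := by
  intro p
  obtain ⟨s, hs, hsf⟩ := locallyFinite_gridIcc hh p.1
  obtain ⟨t, ht, htf⟩ := locallyFinite_gridIcc hh p.2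
  refine ⟨s ×ˢ t, prod_mem_nhds hs ht, (hsf.prod htf).subset ?_⟩
  rintro ⟨i, j⟩ ⟨q, ⟨h1, h2⟩, h3, h4⟩
  exact ⟨⟨_, h1, h3⟩, ⟨_, h2, h4⟩⟩

/-- Compatible maps of the squares of a grid, together with their values on the sides. -/
theorem exists_of_grid_squares {Z : Type*} [TopologicalSpace Z] (hh : 0 < h)
    (Φ : ℤ → ℤ → ℝ × ℝ → Z) (hf wf : ℤ → ℤ → ℝ → Z)
    (cΦ : ∀ i j, ContinuousOn (Φ i j) (gridQ h i j))
    (bot : ∀ i j, ∀ x ∈ gridIcc h i, Φ i j (x, (j : ℝ) * h) = hf i j x)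
    (top : ∀ i j, ∀ x ∈ gridIcc h i, Φ i j (x, ((j + 1 : ℤ) : ℝ) * h) = hf i (j + 1) x)
    (lft : ∀ i j, ∀ y ∈ gridIcc h j, Φ i j ((i : ℝ) * h, y) = wf i j y)
    (rgt : ∀ i j, ∀ y ∈ gridIcc h j, Φ i j (((i + 1 : ℤ) : ℝ) * h, y) = wf (i + 1) j y) :
    ∃ β : ℝ × ℝ → Z, Continuous β ∧ ∀ i j, EqOn β (Φ i j) (gridQ h i j) := by
  -- The index is corrected in the column first and then in the row, so that even at a corner each
  -- correction crosses a single side.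
  have key : ∀ i j, EqOn (fun p => Φ ⌊p.1 / h⌋ ⌊p.2 / h⌋ p) (Φ i j) (gridQ h i j) := by
    rintro i j ⟨x, y⟩ ⟨hx, hy⟩
    simp only at hx hy ⊢
    have step1 : Φ ⌊x / h⌋ j (x, y) = Φ i j (x, y) := by
      rcases floor_of_mem_gridIcc hh hx with h1 | ⟨h1, h2⟩
      · rw [h1]
      · rw [h1, h2, rgt _ _ _ hy, lft _ _ _ hy]
    rw [← step1]
    rcases floor_of_mem_gridIcc hh hy with h1 | ⟨h1, h2⟩
    · rw [h1]
    · rw [h1, h2, top _ _ _ (mem_gridIcc_floor hh x), bot _ _ _ (mem_gridIcc_floor hh x)]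
  refine ⟨fun p => Φ ⌊p.1 / h⌋ ⌊p.2 / h⌋ p, ?_, key⟩
  refine (locallyFinite_gridQ hh).continuous ?_ (fun ij => isClosed_gridQ _ _) fun ij =>
    (cΦ ij.1 ij.2).congr (key _ _)
  rw [eq_univ_iff_forall]
  intro p
  exact mem_iUnion.2 ⟨(⌊p.1 / h⌋, ⌊p.2 / h⌋), mem_gridIcc_floor hh _, mem_gridIcc_floor hh _⟩

/-- Extension over the plane of a map that is given on some cells of a grid. The image of each cell
is prescribed to lie in a given set. -/
theorem exists_grid_extension {Z : Type*} [TopologicalSpace Z] (hh : 0 < h) (F : Set (ℝ × ℝ))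
    (β₀ : ℝ × ℝ → Z) (hβ₀ : ContinuousOn β₀ F) (ZV ZH ZW ZQ : ℤ → ℤ → Set Z)
    (vh : ∀ i j, ZV i j ⊆ ZH i j) (vh' : ∀ i j, ZV (i + 1) j ⊆ ZH i j)
    (vw : ∀ i j, ZV i j ⊆ ZW i j) (vw' : ∀ i j, ZV i (j + 1) ⊆ ZW i j)
    (hq : ∀ i j, ZH i j ⊆ ZQ i j) (hq' : ∀ i j, ZH i (j + 1) ⊆ ZQ i j)
    (wq : ∀ i j, ZW i j ⊆ ZQ i j) (wq' : ∀ i j, ZW (i + 1) j ⊆ ZQ i j)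
    (mV : ∀ i j, gridPt h i j ∈ F → β₀ (gridPt h i j) ∈ ZV i j)
    (mH : ∀ i j, gridH h i j ⊆ F → MapsTo β₀ (gridH h i j) (ZH i j))
    (mW : ∀ i j, gridW h i j ⊆ F → MapsTo β₀ (gridW h i j) (ZW i j))
    (mQ : ∀ i j, gridQ h i j ⊆ F → MapsTo β₀ (gridQ h i j) (ZQ i j))
    (nV : ∀ i j, gridPt h i j ∉ F → (ZV i j).Nonempty)
    (pH : ∀ i j, ¬ gridH h i j ⊆ F → IsPathConnected (ZH i j))
    (pW : ∀ i j, ¬ gridW h i j ⊆ F → IsPathConnected (ZW i j))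
    (sQ : ∀ i j, ¬ gridQ h i j ⊆ F → SquareFills (ZQ i j)) :
    ∃ β : ℝ × ℝ → Z, Continuous β ∧ (∀ i j, MapsTo β (gridQ h i j) (ZQ i j)) ∧
      (∀ i j, gridPt h i j ∈ F → β (gridPt h i j) = β₀ (gridPt h i j)) ∧
      (∀ i j, gridH h i j ⊆ F → EqOn β β₀ (gridH h i j)) ∧
      (∀ i j, gridW h i j ⊆ F → EqOn β β₀ (gridW h i j)) := by
  have lm := left_mem_gridIcc hh
  have rm := right_mem_gridIcc hh
  have exV : ∀ i j, ∃ z ∈ ZV i j, gridPt h i j ∈ F → z = β₀ (gridPt h i j) := by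
    intro i j
    by_cases hF : gridPt h i j ∈ F
    · exact ⟨_, mV i j hF, fun _ => rfl⟩
    · obtain ⟨z, hz⟩ := nV i j hF
      exact ⟨z, hz, fun h' => absurd h' hF⟩
  choose v hv hvF using exV
  have exH : ∀ i j, ∃ γ : ℝ → Z, ContinuousOn γ (gridIcc h i) ∧ MapsTo γ (gridIcc h i) (ZH i j) ∧
      γ ((i : ℝ) * h) = v i j ∧ γ (((i + 1 : ℤ) : ℝ) * h) = v (i + 1) j ∧
      (gridH h i j ⊆ F → ∀ x ∈ gridIcc h i, γ x = β₀ (x, (j : ℝ) * h)) := by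
    intro i j
    by_cases hF : gridH h i j ⊆ F
    · refine ⟨fun x => β₀ (x, (j : ℝ) * h),
        hβ₀.comp (by fun_prop) fun x hx => hF ⟨hx, rfl⟩, fun x hx => mH i j hF ⟨hx, rfl⟩,
        (hvF i j (hF ⟨lm i, rfl⟩)).symm, (hvF (i + 1) j (hF ⟨rm i, rfl⟩)).symm, fun _ x _ => rfl⟩
    -- An edge only partly in `F` forgets `β₀` in its interior. For this reason agreement with `β₀`
    -- is claimed cell by cell.
    · obtain ⟨γ, h1, h2, h3, h4⟩ := (pH i j hF).exists_fun (vh i j (hv i j))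
        (vh' i j (hv (i + 1) j)) (grid_lt hh i)
      exact ⟨γ, h1.continuousOn, fun x _ => h2 x, h3, h4, fun h' => absurd h' hF⟩
  choose hf chf mhf hfl hfr hfF using exH
  have exW : ∀ i j, ∃ γ : ℝ → Z, ContinuousOn γ (gridIcc h j) ∧ MapsTo γ (gridIcc h j) (ZW i j) ∧
      γ ((j : ℝ) * h) = v i j ∧ γ (((j + 1 : ℤ) : ℝ) * h) = v i (j + 1) ∧
      (gridW h i j ⊆ F → ∀ x ∈ gridIcc h j, γ x = β₀ ((i : ℝ) * h, x)) := by
    intro i j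
    by_cases hF : gridW h i j ⊆ F
    · refine ⟨fun x => β₀ ((i : ℝ) * h, x),
        hβ₀.comp (by fun_prop) fun x hx => hF ⟨rfl, hx⟩, fun x hx => mW i j hF ⟨rfl, hx⟩,
        (hvF i j (hF ⟨rfl, lm j⟩)).symm, (hvF i (j + 1) (hF ⟨rfl, rm j⟩)).symm, fun _ x _ => rfl⟩
    · obtain ⟨γ, h1, h2, h3, h4⟩ := (pW i j hF).exists_fun (vw i j (hv i j))
        (vw' i j (hv i (j + 1))) (grid_lt hh j)
      exact ⟨γ, h1.continuousOn, fun x _ => h2 x, h3, h4, fun h' => absurd h' hF⟩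
  choose wf cwf mwf wfl wfr wfF using exW
  have exQ : ∀ i j, ∃ Φ : ℝ × ℝ → Z, ContinuousOn Φ (gridQ h i j) ∧
      MapsTo Φ (gridQ h i j) (ZQ i j) ∧
      (∀ x ∈ gridIcc h i, Φ (x, (j : ℝ) * h) = hf i j x) ∧
      (∀ x ∈ gridIcc h i, Φ (x, ((j + 1 : ℤ) : ℝ) * h) = hf i (j + 1) x) ∧
      (∀ y ∈ gridIcc h j, Φ ((i : ℝ) * h, y) = wf i j y) ∧
      (∀ y ∈ gridIcc h j, Φ (((i + 1 : ℤ) : ℝ) * h, y) = wf (i + 1) j y) := by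
    intro i j
    by_cases hF : gridQ h i j ⊆ F
    · refine ⟨β₀, hβ₀.mono hF, mQ i j hF, fun x hx => ?_, fun x hx => ?_, fun x hx => ?_,
        fun x hx => ?_⟩
      · rw [hfF i j (fun p hp => hF ⟨hp.1, by rw [hp.2]; exact lm j⟩) x hx]
      · rw [hfF i (j + 1) (fun p hp => hF ⟨hp.1, by rw [hp.2]; exact rm j⟩) x hx]
      · rw [wfF i j (fun p hp => hF ⟨by rw [hp.1]; exact lm i, hp.2⟩) x hx]
      · rw [wfF (i + 1) j (fun p hp => hF ⟨by rw [hp.1]; exact rm i, hp.2⟩) x hx]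
    · exact (sQ i j hF).exists_fill (grid_lt hh i) (grid_lt hh j) (chf i j) (chf i (j + 1))
        (cwf i j) (cwf (i + 1) j) ((mhf i j).mono_right (hq i j))
        ((mhf i (j + 1)).mono_right (hq' i j)) ((mwf i j).mono_right (wq i j))
        ((mwf (i + 1) j).mono_right (wq' i j)) ((hfl _ _).trans (wfl _ _).symm)
        ((hfr _ _).trans (wfl _ _).symm) ((hfl _ _).trans (wfr _ _).symm)
        ((hfr _ _).trans (wfr _ _).symm)
  choose Φ cΦ mΦ bot top lft rgt using exQ
  obtain ⟨β, cβ, eβ⟩ := exists_of_grid_squares hh Φ hf wf cΦ bot top lft rgt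
  refine ⟨β, cβ, fun i j p hp => by rw [eβ i j hp]; exact mΦ i j hp, fun i j hF => ?_,
    fun i j hF => ?_, fun i j hF => ?_⟩
  · rw [eβ i j ⟨lm i, lm j⟩, ← hvF i j hF, ← hfl i j]
    exact bot i j _ (lm i)
  · rintro ⟨x, y⟩ ⟨hx, hy⟩
    simp only [mem_singleton_iff] at hx hy
    subst hy
    rw [eβ i j ⟨hx, lm j⟩, bot i j x hx, hfF i j hF x hx]
  · rintro ⟨x, y⟩ ⟨hx, hy⟩
    simp only [mem_singleton_iff] at hx hy
    subst hx
    rw [eβ i j ⟨lm i, hy⟩, lft i j y hy, wfF i j hF y hy]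

end grid

/-- Take the Lebesgue number of the cover of `K` by relatively open preimages, and `N` with `1 / N`
below it. An empty `T` gets an arbitrary index. -/
theorem exists_mesh {X ι : Type*} [TopologicalSpace X] [Nonempty ι] {K : Set (ℝ × ℝ)}
    (hK : IsCompact K) {g : ℝ × ℝ → X} (hg : ContinuousOn g K) {c : ι → Set X}
    (hc : ∀ k, IsOpen (c k)) (hgc : ∀ x ∈ K, ∃ k, g x ∈ c k) :
    ∃ N : ℕ, 0 < N ∧ ∀ T ⊆ K, (∀ x ∈ T, ∀ y ∈ T, dist x y ≤ 1 / (N : ℝ)) → ∃ k, MapsTo g T (c k) := by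
  choose O hO hOK using fun k => (continuousOn_iff'.1 hg) (c k) (hc k)
  obtain ⟨δ, hδ, hb⟩ := lebesgue_number_lemma_of_metric hK hO (fun x hx => by
    obtain ⟨k, hk⟩ := hgc x hx
    exact mem_iUnion.2 ⟨k, ((hOK k).subset ⟨hk, hx⟩).1⟩)
  obtain ⟨n, hn⟩ := exists_nat_one_div_lt hδ
  refine ⟨n + 1, n.succ_pos, fun T hT hd => ?_⟩
  rcases T.eq_empty_or_nonempty with rfl | ⟨x, hx⟩
  · exact ⟨Classical.arbitrary ι, mapsTo_empty _ _⟩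
  · obtain ⟨k, hk⟩ := hb x (hT hx)
    refine ⟨k, fun y hy => ?_⟩
    have h1 : dist y x < δ := (hd y hy x hx).trans_lt (by push_cast; exact hn)
    exact ((hOK k).symm.subset ⟨hk h1, hT hy⟩).1

theorem dist_le_of_mem_gridQ {N : ℕ} {i j : ℤ} {x y : ℝ × ℝ}
    (hx : x ∈ gridQ (1 / (N : ℝ)) i j) (hy : y ∈ gridQ (1 / (N : ℝ)) i j) :
    dist x y ≤ 1 / (N : ℝ) := by
  have key : ∀ {s t : ℝ} {i : ℤ}, s ∈ gridIcc (1 / (N : ℝ)) i → t ∈ gridIcc (1 / (N : ℝ)) i →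
      dist s t ≤ 1 / (N : ℝ) := by
    intro s t i hs ht
    have := Real.dist_le_of_mem_Icc hs ht
    push_cast at this
    linarith
  rw [Prod.dist_eq]
  exact max_le (key hx.1 hy.1) (key hx.2 hy.2)

/-- The retraction of the plane onto the unit square. -/
noncomputable def clampSq (p : ℝ × ℝ) : ℝ × ℝ :=
  (projIcc (0 : ℝ) 1 zero_le_one p.1, projIcc (0 : ℝ) 1 zero_le_one p.2)

theorem clampSq_mem (p : ℝ × ℝ) : clampSq p ∈ unitSq := ⟨Subtype.coe_prop _, Subtype.coe_prop _⟩

theorem clampSq_of_mem {p : ℝ × ℝ} (hp : p ∈ unitSq) : clampSq p = p := by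
  rw [clampSq, projIcc_of_mem _ hp.1, projIcc_of_mem _ hp.2]

theorem continuous_clampSq : Continuous clampSq :=
  ((continuous_subtype_val.comp continuous_projIcc).comp continuous_fst).prodMk
    ((continuous_subtype_val.comp continuous_projIcc).comp continuous_snd)

theorem dist_clampSq_le (p q : ℝ × ℝ) : dist (clampSq p) (clampSq q) ≤ dist p q := by
  have key : ∀ s t : ℝ, dist (projIcc (0 : ℝ) 1 zero_le_one s : ℝ)
      (projIcc (0 : ℝ) 1 zero_le_one t) ≤ dist s t := fun s t => by
    have := (LipschitzWith.projIcc (zero_le_one (α := ℝ))).dist_le_mul s t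
    simpa [Subtype.dist_eq] using this
  rw [Prod.dist_eq, Prod.dist_eq]
  exact max_le_max (key _ _) (key _ _)

/-- A map of the unit square, extended to the plane, is small on the squares of a fine grid. -/
theorem exists_mesh_clampSq {X ι : Type*} [TopologicalSpace X] [Nonempty ι]
    {g : ℝ × ℝ → X} (hg : ContinuousOn g unitSq) {c : ι → Set X}
    (hc : ∀ k, IsOpen (c k)) (hgc : ∀ x ∈ unitSq, ∃ k, g x ∈ c k) :
    ∃ N : ℕ, 0 < N ∧ ∀ i j, ∃ k, MapsTo (g ∘ clampSq) (gridQ (1 / (N : ℝ)) i j) (c k) := by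
  obtain ⟨N, hN, h⟩ := exists_mesh isCompact_unitSq hg hc hgc
  refine ⟨N, hN, fun i j => ?_⟩
  obtain ⟨k, hk⟩ := h (clampSq '' gridQ (1 / (N : ℝ)) i j)
    (by rintro _ ⟨p, -, rfl⟩; exact clampSq_mem p) (by
      rintro _ ⟨p, hp, rfl⟩ _ ⟨q, hq, rfl⟩
      exact (dist_clampSq_le p q).trans (dist_le_of_mem_gridQ hp hq))
  exact ⟨k, fun p hp => hk (mem_image_of_mem _ hp)⟩

theorem exists_gridIcc_subset {N : ℕ} (hN : 0 < N) {x : ℝ} (hx : x ∈ Icc (0 : ℝ) 1) :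
    ∃ i : ℤ, x ∈ gridIcc (1 / (N : ℝ)) i ∧ gridIcc (1 / (N : ℝ)) i ⊆ Icc 0 1 := by
  have hN' : (0 : ℝ) < N := by exact_mod_cast hN
  have hh : (0 : ℝ) < 1 / N := by positivity
  have sub : ∀ i : ℤ, 0 ≤ i → i + 1 ≤ N → gridIcc (1 / (N : ℝ)) i ⊆ Icc 0 1 := by
    intro i h0 h1 y hy
    have h0' : (0 : ℝ) ≤ i := by exact_mod_cast h0
    have h1' : ((i + 1 : ℤ) : ℝ) ≤ N := by exact_mod_cast h1
    refine ⟨le_trans (by positivity) hy.1, hy.2.trans ?_⟩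
    rw [mul_one_div, div_le_one hN']
    exact h1'
  rcases hx.2.eq_or_lt with rfl | h1
  -- At the right end the floor would select an interval outside the unit interval, so the last
  -- interval inside it is used.
  · refine ⟨N - 1, ⟨?_, ?_⟩, sub _ (by omega) (by omega)⟩
    · push_cast
      rw [mul_one_div, div_le_one hN']; linarith
    · push_cast
      rw [mul_one_div, le_div_iff₀ hN']; linarith
  · refine ⟨⌊x / (1 / N)⌋, mem_gridIcc_floor hh x, sub _ ?_ ?_⟩
    · exact Int.floor_nonneg.2 (div_nonneg hx.1 hh.le)
    · rw [Int.add_one_le_iff, Int.floor_lt, div_lt_iff₀ hh]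
      have : ((N : ℤ) : ℝ) * (1 / N) = 1 := by push_cast; field_simp
      rw [this]; exact h1

theorem gridPt_zero (h : ℝ) : gridPt h 0 0 = (0, 0) := by simp [gridPt]

theorem gridPt_one {N : ℕ} (hN : 0 < N) : gridPt (1 / (N : ℝ)) N 0 = (1, 0) := by
  have : (N : ℝ) ≠ 0 := by exact_mod_cast hN.ne'
  simp [gridPt, this]

/-- If a map agrees with another on all grid edges in the boundary of the unit square, then it does
so on the boundary. -/
theorem eqOn_unitSqBd_of_edges {Z : Type*} {N : ℕ} (hN : 0 < N) {β β₀ : ℝ × ℝ → Z}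
    (hH : ∀ i j, gridH (1 / (N : ℝ)) i j ⊆ unitSqBd → EqOn β β₀ (gridH (1 / (N : ℝ)) i j))
    (hW : ∀ i j, gridW (1 / (N : ℝ)) i j ⊆ unitSqBd → EqOn β β₀ (gridW (1 / (N : ℝ)) i j)) :
    EqOn β β₀ unitSqBd := by
  have hN' : (N : ℝ) ≠ 0 := by exact_mod_cast hN.ne'
  have z0 : (0:ℝ) ∈ Icc (0:ℝ) 1 := by simp
  have z1 : (1:ℝ) ∈ Icc (0:ℝ) 1 := by simp
  have e0 : ((0 : ℤ) : ℝ) * (1 / (N : ℝ)) = 0 := by simp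
  have e1 : ((N : ℤ) : ℝ) * (1 / (N : ℝ)) = 1 := by push_cast; field_simp
  rintro ⟨x, y⟩ ⟨⟨hx, hy⟩, h⟩
  simp only at hx hy h
  obtain ⟨i, hi, si⟩ := exists_gridIcc_subset hN hx
  obtain ⟨j, hj, sj⟩ := exists_gridIcc_subset hN hy
  rcases h with rfl | rfl | rfl | rfl
  · refine hW 0 j ?_ ⟨e0.symm, hj⟩
    rintro ⟨a, b⟩ ⟨ha, hb⟩
    simp only [mem_singleton_iff, e0] at ha hb; subst ha
    exact ⟨⟨z0, sj hb⟩, by simp⟩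
  · refine hW N j ?_ ⟨e1.symm, hj⟩
    rintro ⟨a, b⟩ ⟨ha, hb⟩
    simp only [mem_singleton_iff, e1] at ha hb; subst ha
    exact ⟨⟨z1, sj hb⟩, by simp⟩
  · refine hH i 0 ?_ ⟨hi, e0.symm⟩
    rintro ⟨a, b⟩ ⟨ha, hb⟩
    simp only [mem_singleton_iff, e0] at ha hb; subst hb
    exact ⟨⟨si ha, z0⟩, by simp⟩
  · refine hH i N ?_ ⟨hi, e1.symm⟩
    rintro ⟨a, b⟩ ⟨ha, hb⟩
    simp only [mem_singleton_iff, e1] at ha hb; subst hb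
    exact ⟨⟨si ha, z1⟩, by simp⟩

section gridsub
variable {h : ℝ} (hh : 0 < h) (i j : ℤ)
include hh

theorem gridPt_mem_gridH : gridPt h i j ∈ gridH h i j := ⟨left_mem_gridIcc hh i, rfl⟩
theorem gridPt_mem_gridH' : gridPt h (i + 1) j ∈ gridH h i j := ⟨right_mem_gridIcc hh i, rfl⟩
theorem gridPt_mem_gridW : gridPt h i j ∈ gridW h i j := ⟨rfl, left_mem_gridIcc hh j⟩
theorem gridPt_mem_gridW' : gridPt h i (j + 1) ∈ gridW h i j := ⟨rfl, right_mem_gridIcc hh j⟩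
theorem gridH_subset : gridH h i j ⊆ gridQ h i j :=
  prod_mono_right (singleton_subset_iff.2 (left_mem_gridIcc hh j))
theorem gridH_subset' : gridH h i (j + 1) ⊆ gridQ h i j :=
  prod_mono_right (singleton_subset_iff.2 (right_mem_gridIcc hh j))
theorem gridW_subset : gridW h i j ⊆ gridQ h i j :=
  prod_mono_left (singleton_subset_iff.2 (left_mem_gridIcc hh i))
theorem gridW_subset' : gridW h (i + 1) j ⊆ gridQ h i j :=
  prod_mono_left (singleton_subset_iff.2 (right_mem_gridIcc hh i))

end gridsub

/-- The version of `exists_grid_extension` in which the sets are given by one monotone function of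
the cells. -/
theorem exists_grid_extension_of_mono {Z : Type*} [TopologicalSpace Z] {h : ℝ} (hh : 0 < h)
    (F : Set (ℝ × ℝ)) (β₀ : ℝ × ℝ → Z) (hβ₀ : ContinuousOn β₀ F) (C : Set (ℝ × ℝ) → Set Z)
    (hC : ∀ i j, ∀ c ⊆ gridQ h i j, ∀ d ⊆ c, C d ⊆ C c)
    (mC : ∀ i j, ∀ c ⊆ gridQ h i j, c ⊆ F → MapsTo β₀ c (C c))
    (nV : ∀ i j, gridPt h i j ∉ F → (C {gridPt h i j}).Nonempty)
    (pH : ∀ i j, ¬ gridH h i j ⊆ F → IsPathConnected (C (gridH h i j)))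
    (pW : ∀ i j, ¬ gridW h i j ⊆ F → IsPathConnected (C (gridW h i j)))
    (sQ : ∀ i j, ¬ gridQ h i j ⊆ F → SquareFills (C (gridQ h i j))) :
    ∃ β : ℝ × ℝ → Z, Continuous β ∧ (∀ i j, MapsTo β (gridQ h i j) (C (gridQ h i j))) ∧
      (∀ i j, gridPt h i j ∈ F → β (gridPt h i j) = β₀ (gridPt h i j)) ∧
      (∀ i j, gridH h i j ⊆ F → EqOn β β₀ (gridH h i j)) ∧
      (∀ i j, gridW h i j ⊆ F → EqOn β β₀ (gridW h i j)) := by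
  have Hs := gridH_subset hh
  have Ws := gridW_subset hh
  have ss : ∀ {p : ℝ × ℝ} {s : Set (ℝ × ℝ)}, p ∈ s → {p} ⊆ s := fun h => singleton_subset_iff.2 h
  exact exists_grid_extension hh F β₀ hβ₀ (fun i j => C {gridPt h i j}) (fun i j => C (gridH h i j))
    (fun i j => C (gridW h i j)) (fun i j => C (gridQ h i j))
    (fun i j => hC i j _ (Hs i j) _ (ss (gridPt_mem_gridH hh i j)))
    (fun i j => hC i j _ (Hs i j) _ (ss (gridPt_mem_gridH' hh i j)))
    (fun i j => hC i j _ (Ws i j) _ (ss (gridPt_mem_gridW hh i j)))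
    (fun i j => hC i j _ (Ws i j) _ (ss (gridPt_mem_gridW' hh i j)))
    (fun i j => hC i j _ subset_rfl _ (Hs i j)) (fun i j => hC i j _ subset_rfl _ (gridH_subset' hh i j))
    (fun i j => hC i j _ subset_rfl _ (Ws i j)) (fun i j => hC i j _ subset_rfl _ (gridW_subset' hh i j))
    (fun i j hF => mC i j _ (ss (Hs i j (gridPt_mem_gridH hh i j))) (ss hF) rfl)
    (fun i j hF => mC i j _ (Hs i j) hF) (fun i j hF => mC i j _ (Ws i j) hF)
    (fun i j hF => mC i j _ subset_rfl hF) nV pH pW sQ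

/-! ### Van Kampen, removal of points, and transfer of 1-connectedness -/

/-- The union of two open 1-connected sets with path connected intersection is 1-connected. -/
theorem OneConnected.union {Z : Type*} [TopologicalSpace Z] {U V : Set Z} (hU : OneConnected U)
    (hV : OneConnected V) (oU : IsOpen U) (oV : IsOpen V) (hUV : IsPathConnected (U ∩ V)) :
    OneConnected (U ∪ V) := by
  refine ⟨hU.1.union hV.1 hUV.nonempty, fun g cg mg => ?_⟩
  let c : Bool → Set Z := fun b => cond b U V
  have hc : ∀ b, OneConnected (c b) := by rintro (_ | _) <;> assumption
  have oc : ∀ b, IsOpen (c b) := by rintro (_ | _) <;> assumption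
  have cc : ∀ b, c b ⊆ U ∪ V := by rintro (_ | _); exacts [subset_union_right, subset_union_left]
  have hcc : ∀ b, U ∩ V ⊆ c b := by rintro (_ | _); exacts [inter_subset_right, inter_subset_left]
  obtain ⟨N, hN, hb⟩ := exists_mesh (isCompact_unitSq.of_isClosed_subset isClosed_unitSqBd
    unitSqBd_subset) cg oc (fun x hx => (mg hx).elim (fun h => ⟨true, h⟩) fun h => ⟨false, h⟩)
  have hN' : (N : ℝ) ≠ 0 := by exact_mod_cast hN.ne'
  have hh : 0 < 1 / (N : ℝ) := by positivity
  set h : ℝ := 1 / (N : ℝ) with hdef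
  -- Every square is labelled by `U` or `V` according to where `g` sends its part of the boundary;
  -- squares that miss the boundary receive some label as well.
  choose b hb using fun i j => hb (unitSqBd ∩ gridQ h i j) inter_subset_left
    (fun x hx y hy => dist_le_of_mem_gridQ hx.2 hy.2)
  -- A cell must go into the sets of all squares containing it. For a vertex or an edge this is `U`,
  -- `V` or `U ∩ V`, all path connected. A square lies in no other square, so it may be filled in
  -- its own set.
  let C : Set (ℝ × ℝ) → Set Z := fun s => {z | ∀ i j, s ⊆ gridQ h i j → z ∈ c (b i j)}
  have Csub : ∀ i j, ∀ s ⊆ gridQ h i j, C s ⊆ c (b i j) := fun i j s hs z hz => hz i j hs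
  have Ceq : ∀ s : Set (ℝ × ℝ), (∃ i j, s ⊆ gridQ h i j) → (∃ d, C s = c d) ∨ C s = U ∩ V := by
    rintro s ⟨i, j, hs⟩
    by_cases hsame : ∀ i' j', s ⊆ gridQ h i' j' → b i' j' = b i j
    · refine Or.inl ⟨b i j, (Csub i j s hs).antisymm fun z hz i' j' hs' => ?_⟩
      rw [hsame i' j' hs']; exact hz
    · push Not at hsame
      obtain ⟨i', j', hs', hne⟩ := hsame
      refine Or.inr (Subset.antisymm (fun z hz => ?_) fun z hz i j _ => hcc _ hz)
      have h1 := hz i j hs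
      have h2 := hz i' j' hs'
      cases hd : b i j <;> cases hd' : b i' j' <;> simp_all [c]
  have Cpc : ∀ s : Set (ℝ × ℝ), (∃ i j, s ⊆ gridQ h i j) → IsPathConnected (C s) := by
    intro s hs
    rcases Ceq s hs with ⟨d, hd⟩ | hd
    · rw [hd]; exact (hc d).1
    · rw [hd]; exact hUV
  have gridQ_eq : ∀ i j i' j', gridQ h i j ⊆ gridQ h i' j' → i = i' ∧ j = j' := by
    intro i j i' j' hs
    have h1 : gridPt h i j ∈ gridQ h i' j' := hs ⟨left_mem_gridIcc hh i, left_mem_gridIcc hh j⟩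
    have h2 : gridPt h (i + 1) (j + 1) ∈ gridQ h i' j' :=
      hs ⟨right_mem_gridIcc hh i, right_mem_gridIcc hh j⟩
    have k1 := le_of_mul_le_mul_right h1.1.1 hh
    have k2 := le_of_mul_le_mul_right h2.1.2 hh
    have k3 := le_of_mul_le_mul_right h1.2.1 hh
    have k4 := le_of_mul_le_mul_right h2.2.2 hh
    norm_cast at k1 k2 k3 k4
    omega
  have CQ : ∀ i j, C (gridQ h i j) = c (b i j) := fun i j =>
    (Csub i j _ subset_rfl).antisymm fun z hz i' j' hs => by
      obtain ⟨rfl, rfl⟩ := gridQ_eq _ _ _ _ hs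
      exact hz
  obtain ⟨β, cβ, mβ, -, eH, eW⟩ := exists_grid_extension_of_mono hh unitSqBd g cg C
    (fun i j s hs d hd z hz i' j' hs' => hz i' j' (hd.trans hs'))
    (fun i j s hs hF x hx i' j' hs' => hb i' j' ⟨hF hx, hs' hx⟩)
    (fun i j _ => (Cpc _ ⟨i, j, singleton_subset_iff.2
      (gridH_subset hh i j (gridPt_mem_gridH hh i j))⟩).nonempty)
    (fun i j _ => Cpc _ ⟨i, j, gridH_subset hh i j⟩)
    (fun i j _ => Cpc _ ⟨i, j, gridW_subset hh i j⟩)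
    (fun i j _ => by rw [CQ]; exact (hc _).2)
  refine ⟨β, cβ.continuousOn, fun p _ => ?_, eqOn_unitSqBd_of_edges hN eH eW⟩
  have := mβ ⌊p.1 / h⌋ ⌊p.2 / h⌋ ⟨mem_gridIcc_floor hh p.1, mem_gridIcc_floor hh p.2⟩
  rw [CQ] at this
  exact cc _ this

/-- A map of the square to `O` that sends some boundary part off `x₀` can be moved off `x₀`. -/
theorem exists_avoiding {X : Type*} [TopologicalSpace X] [T1Space X] {O V : Set X} {x₀ : X}
    (oV : IsOpen V) (hx₀ : x₀ ∈ V) (hVO : V ⊆ O) (hV : OneConnected (V \ {x₀}))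
    {α : ℝ × ℝ → X} (cα : ContinuousOn α unitSq) (mα : MapsTo α unitSq O) :
    ∃ β : ℝ × ℝ → X, Continuous β ∧ (∀ p, β p ∈ O \ {x₀}) ∧
      (α (0, 0) ≠ x₀ → β (0, 0) = α (0, 0)) ∧ (α (1, 0) ≠ x₀ → β (1, 0) = α (1, 0)) ∧
      (MapsTo α unitSqBd {x₀}ᶜ → EqOn β α unitSqBd) := by
  classical
  let c : Bool → Set X := fun b => cond b V {x₀}ᶜ
  have oc : ∀ b, IsOpen (c b) := by rintro (_ | _); exacts [isOpen_compl_singleton, oV]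
  obtain ⟨N, hN, hb⟩ := exists_mesh_clampSq cα oc (fun x hx => by
    by_cases h : α x = x₀
    · exact ⟨true, by rw [h]; exact hx₀⟩
    · exact ⟨false, h⟩)
  have hN' : (N : ℝ) ≠ 0 := by exact_mod_cast hN.ne'
  have hh : 0 < 1 / (N : ℝ) := by positivity
  set h : ℝ := 1 / (N : ℝ) with hdef
  let α' := α ∘ clampSq
  have cα' : Continuous α' := cα.comp_continuous continuous_clampSq clampSq_mem
  have mα' : ∀ p, α' p ∈ O := fun p => mα (clampSq_mem p)
  have eα' : ∀ p ∈ unitSq, α' p = α p := fun p hp => congrArg α (clampSq_of_mem hp)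
  -- Cells that already avoid `x₀` keep the given map. A cell not contained in `F` meets the
  -- preimage of `x₀`, so its square is of the kind mapped into `V`.
  let F : Set (ℝ × ℝ) := α' ⁻¹' {x₀}ᶜ
  have hb' : ∀ i j, ∀ s ⊆ gridQ h i j, ¬ s ⊆ F → MapsTo α' s V := by
    intro i j s hs hsF
    obtain ⟨k, hk⟩ := hb i j
    cases k
    · exact absurd (fun x hx => hk (hs hx)) hsF
    · exact fun x hx => hk (hs hx)
  -- This is monotone because a face of a cell mapped into `V` is mapped into `V`. Cells to be
  -- redone are redone inside the punctured neighbourhood.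
  let C : Set (ℝ × ℝ) → Set X := fun s => if MapsTo α' s V then V \ {x₀} else O \ {x₀}
  have Csub : ∀ s, C s ⊆ O \ {x₀} := fun s => by
    simp only [C]; split_ifs
    · exact sdiff_subset_sdiff_left hVO
    · exact subset_rfl
  have Ceq : ∀ i j, ∀ s ⊆ gridQ h i j, ¬ s ⊆ F → C s = V \ {x₀} := fun i j s hs hsF =>
    if_pos (hb' i j s hs hsF)
  have Hs := gridH_subset hh
  have Ws := gridW_subset hh
  have Ps : ∀ i j, {gridPt h i j} ⊆ gridQ h i j := fun i j =>
    singleton_subset_iff.2 (Hs i j (gridPt_mem_gridH hh i j))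
  obtain ⟨β, cβ, mβ, eV, eH, eW⟩ := exists_grid_extension_of_mono hh F α' cα'.continuousOn C
    (fun i j s hs d hd => by
      by_cases h1 : MapsTo α' s V
      · simp only [C, if_pos h1, if_pos (h1.mono_left hd)]; exact subset_rfl
      · simp only [C, if_neg h1]; exact Csub d)
    (fun i j s hs hF x hx => by
      by_cases h1 : MapsTo α' s V
      · simp only [C, if_pos h1]; exact ⟨h1 hx, hF hx⟩
      · simp only [C, if_neg h1]; exact ⟨mα' x, hF hx⟩)
    (fun i j hF => by
      rw [Ceq i j _ (Ps i j) (by simpa using hF)]; exact hV.1.nonempty)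
    (fun i j hF => by rw [Ceq i j _ (Hs i j) hF]; exact hV.1)
    (fun i j hF => by rw [Ceq i j _ (Ws i j) hF]; exact hV.1)
    (fun i j hF => by rw [Ceq i j _ subset_rfl hF]; exact hV.2)
  refine ⟨β, cβ, fun p => ?_, fun h0 => ?_, fun h1 => ?_, fun hbd => ?_⟩
  · exact Csub _ (mβ _ _ ⟨mem_gridIcc_floor hh p.1, mem_gridIcc_floor hh p.2⟩)
  · have e := eα' (0, 0) ⟨by simp, by simp⟩
    have := eV 0 0
    rw [gridPt_zero] at this
    rw [this (by simpa [F, e] using h0), e]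
  · have e := eα' (1, 0) ⟨by simp, by simp⟩
    have := eV N 0
    rw [gridPt_one hN] at this
    rw [this (by simpa [F, e] using h1), e]
  · have sF : unitSqBd ⊆ F := fun p hp => by
      simp only [F, mem_preimage, eα' p (unitSqBd_subset hp)]; exact hbd hp
    intro p hp
    rw [← eα' p (unitSqBd_subset hp)]
    exact eqOn_unitSqBd_of_edges hN (fun i j hs => eH i j (hs.trans sF))
      (fun i j hs => eW i j (hs.trans sF)) hp

/-- Removing a point that has punctured 1-connected neighbourhoods. -/
theorem OneConnected.diff_singleton {X : Type*} [TopologicalSpace X] [T1Space X] {O V : Set X}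
    {x₀ : X} (hO : OneConnected O) (oV : IsOpen V) (hx₀ : x₀ ∈ V) (hVO : V ⊆ O)
    (hV : OneConnected (V \ {x₀})) : OneConnected (O \ {x₀}) := by
  constructor
  · obtain ⟨a, ha⟩ := hV.1.nonempty
    rw [isPathConnected_iff]
    refine ⟨⟨a, hVO ha.1, ha.2⟩, fun a ha b hb => ?_⟩
    obtain ⟨γ, cγ, mγ, rfl, rfl⟩ := hO.1.exists_fun ha.1 hb.1 zero_lt_one
    -- A path is treated as a map of the square that ignores the second coordinate; its ends are
    -- read off at the two lower corners.
    obtain ⟨β, cβ, mβ, e0, e1, -⟩ := exists_avoiding oV hx₀ hVO hV (α := fun p => γ p.1)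
      (by fun_prop) (fun p _ => mγ _)
    refine ⟨⟨⟨fun t => β (t, 0), by fun_prop⟩, ?_, ?_⟩, fun t => mβ _⟩
    · exact e0 ha.2
    · exact e1 hb.2
  · intro g cg mg
    obtain ⟨G, cG, mG, eG⟩ := hO.2 g cg fun p hp => (mg hp).1
    obtain ⟨β, cβ, mβ, -, -, eβ⟩ := exists_avoiding oV hx₀ hVO hV cG mG
    refine ⟨β, cβ.continuousOn, fun p _ => mβ p, fun p hp => ?_⟩
    rw [eβ (fun p hp => by rw [eG hp]; exact (mg hp).2) hp, eG hp]

/-- Fill in `S` after applying `k` and return by `j`. Continuity is required only on the two sets,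
so both maps may take junk values elsewhere; charts, polar coordinates and collapses are all handled
this way. -/
theorem OneConnected.of_retract {X Y : Type*} [TopologicalSpace X] [TopologicalSpace Y] {S : Set X}
    {T : Set Y} (hS : OneConnected S) {j : X → Y} {k : Y → X} (cj : ContinuousOn j S)
    (ck : ContinuousOn k T) (mj : MapsTo j S T) (mk : MapsTo k T S) (jk : ∀ z ∈ T, j (k z) = z) :
    OneConnected T := by
  constructor
  · have : T = j '' S := Subset.antisymm (fun z hz => ⟨k z, mk hz, jk z hz⟩) mj.image_subset
    rw [this]
    exact hS.1.image' cj
  · intro g cg mg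
    obtain ⟨G, cG, mG, eG⟩ := hS.2 (k ∘ g) (ck.comp cg mg) (mk.comp mg)
    exact ⟨j ∘ G, cj.comp cG mG, mj.comp mG, fun p hp => by
      rw [Function.comp_apply, eG hp]; exact jk _ (mg hp)⟩

theorem OneConnected.prod {X Y : Type*} [TopologicalSpace X] [TopologicalSpace Y] {S : Set X}
    {T : Set Y} (hS : OneConnected S) (hT : OneConnected T) : OneConnected (S ×ˢ T) := by
  constructor
  · exact hS.1.prod hT.1
  · intro g cg mg
    obtain ⟨G, cG, mG, eG⟩ := hS.2 (fun p => (g p).1) (by fun_prop) fun p hp => (mg hp).1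
    obtain ⟨H, cH, mH, eH⟩ := hT.2 (fun p => (g p).2) (by fun_prop) fun p hp => (mg hp).2
    exact ⟨fun p => (G p, H p), by fun_prop, fun p hp => ⟨mG hp, mH hp⟩, fun p hp =>
      Prod.ext (eG hp) (eH hp)⟩

theorem OneConnected.of_univ_subtype {X : Type*} [TopologicalSpace X] {S : Set X}
    (hS : OneConnected (univ : Set S)) : OneConnected S := by
  classical
  obtain ⟨s₀, -⟩ := hS.1.nonempty
  refine hS.of_retract (j := Subtype.val) (k := fun x => if h : x ∈ S then ⟨x, h⟩ else s₀)
    continuous_subtype_val.continuousOn ?_ (fun x _ => x.2) (fun _ _ => mem_univ _)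
    (fun z hz => by simp [hz])
  rw [IsInducing.subtypeVal.continuousOn_iff]
  exact continuousOn_id.congr fun x hx => by simp [hx]

/-! ### Simply connected spaces, the 3-sphere and round shells -/

/-- In a simply connected space, maps of the boundary of a square extend to the square. -/
theorem OneConnected.univ_of_simplyConnectedSpace (X : Type*) [TopologicalSpace X]
    [SimplyConnectedSpace X] : OneConnected (univ : Set X) := by
  refine ⟨isPathConnected_univ, fun g cg _ => ?_⟩
  -- The curve `(M t, m t)` runs along the bottom and then the right side, `(m t, M t)` along the
  -- left and then the top side.
  let m : ℝ → ℝ := fun t => max (2 * t - 1) 0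
  let M : ℝ → ℝ := fun t => min (2 * t) 1
  have cm : Continuous m := by fun_prop
  have cM : Continuous M := by fun_prop
  have hm : ∀ t ∈ Icc (0:ℝ) 1, m t ∈ Icc (0:ℝ) 1 := fun t ht =>
    ⟨le_max_right _ _, max_le (by linarith [ht.2]) zero_le_one⟩
  have hM : ∀ t ∈ Icc (0:ℝ) 1, M t ∈ Icc (0:ℝ) 1 := fun t ht =>
    ⟨le_min (by linarith [ht.1]) zero_le_one, min_le_right _ _⟩
  have hsum : ∀ t, M t + m t = 2 * t := fun t => by
    simp only [M, m]; rcases le_total (2 * t) 1 with h | h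
    · rw [min_eq_left h, max_eq_right (by linarith)]; ring
    · rw [min_eq_right h, max_eq_left (by linarith)]; ring
  have hor : ∀ t, m t = 0 ∨ M t = 1 := fun t => by
    rcases le_total (2 * t) 1 with h | h
    · left; exact max_eq_right (by linarith)
    · right; exact min_eq_right h
  have hle : ∀ t ∈ Icc (0:ℝ) 1, m t ≤ M t := fun t ht => by
    rcases hor t with h | h
    · rw [h]; exact (hM t ht).1
    · rw [h]; exact (hm t ht).2
  have hdeg : ∀ t ∈ Icc (0:ℝ) 1, m t = M t → t = 0 ∨ t = 1 := fun t ht h => by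
    have := hsum t
    rcases hor t with h' | h'
    · left; linarith
    · right; linarith
  have b1 : ∀ t ∈ Icc (0:ℝ) 1, (M t, m t) ∈ unitSqBd := fun t ht =>
    ⟨⟨hM t ht, hm t ht⟩, by rcases hor t with h | h <;> simp [h]⟩
  have b2 : ∀ t ∈ Icc (0:ℝ) 1, (m t, M t) ∈ unitSqBd := fun t ht =>
    ⟨⟨hm t ht, hM t ht⟩, by rcases hor t with h | h <;> simp [h]⟩
  let p : Path (g (0, 0)) (g (1, 1)) :=
    { toFun := fun t => g (M t, m t)
      continuous_toFun := cg.comp_continuous (by fun_prop) fun t => b1 t t.2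
      source' := by simp [M, m]
      target' := by norm_num [M, m] }
  let q : Path (g (0, 0)) (g (1, 1)) :=
    { toFun := fun t => g (m t, M t)
      continuous_toFun := cg.comp_continuous (by fun_prop) fun t => b2 t t.2
      source' := by simp [M, m]
      target' := by norm_num [M, m] }
  obtain ⟨H⟩ := SimplyConnectedSpace.paths_homotopic p q
  -- For fixed `t` this traverses the segment of `x + y = 2 * t` inside the square, from one
  -- boundary path to the other.
  let π : unitInterval × unitInterval → unitSq := fun st =>
    ⟨((1 - (st.1 : ℝ)) * M st.2 + st.1 * m st.2, (1 - (st.1 : ℝ)) * m st.2 + st.1 * M st.2), by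
      have h1 := hm st.2 st.2.2
      have h2 := hM st.2 st.2.2
      have h3 := st.1.2
      refine ⟨⟨?_, ?_⟩, ⟨?_, ?_⟩⟩ <;> simp only <;> nlinarith [h1.1, h1.2, h2.1, h2.2, h3.1, h3.2]⟩
  have cπ : Continuous π := by
    refine Continuous.subtype_mk ?_ _
    fun_prop
  have sumπ : ∀ st, (π st).1.1 + (π st).1.2 = 2 * st.2 := fun st => by
    rw [← hsum]; simp only [π]; ring
  have sπ : Function.Surjective π := by
    rintro ⟨⟨x, y⟩, hx, hy⟩
    simp only at hx hy
    have ht : (x + y) / 2 ∈ Icc (0:ℝ) 1 :=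
      ⟨by linarith [hx.1, hy.1], by linarith [hx.2, hy.2]⟩
    set t := (x + y) / 2 with htd
    have hs := hsum t
    have hMx : x ≤ M t ∧ m t ≤ x := by
      rcases hor t with h | h
      · exact ⟨by linarith [hy.1], by linarith [hx.1]⟩
      · exact ⟨by linarith [hx.2], by linarith [hy.2]⟩
    by_cases hd : m t = M t
    · refine ⟨(0, ⟨t, ht⟩), Subtype.ext (Prod.ext ?_ ?_)⟩ <;> simp [π] <;> linarith
    · have hpos : 0 < M t - m t := sub_pos.2 (lt_of_le_of_ne (hle t ht) hd)
      refine ⟨(⟨(M t - x) / (M t - m t), ⟨div_nonneg (by linarith) hpos.le,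
        (div_le_one hpos).2 (by linarith)⟩⟩, ⟨t, ht⟩), Subtype.ext (Prod.ext ?_ ?_)⟩ <;>
      · simp only [π]
        field_simp
        nlinarith
  have qπ : IsQuotientMap π := cπ.isClosedMap.isQuotientMap cπ sπ
  -- The segment degenerates only at the ends of `t`, and there a homotopy relative to endpoints is
  -- constant in `s`. Hence `H` descends along the quotient map `π`.
  have hfib : ∀ a b, π a = π b → H a = H b := by
    rintro ⟨s, t⟩ ⟨s', t'⟩ h
    have ht : t = t' := by
      have h1 := sumπ (s, t)
      have h2 := sumπ (s', t')
      rw [h] at h1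
      exact Subtype.ext (by linarith)
    subst ht
    by_cases hd : m t = M t
    · rcases hdeg t t.2 hd with h0 | h1
      · rw [show t = 0 from Subtype.ext h0]; simp
      · rw [show t = 1 from Subtype.ext h1]; simp
    · have e : (1 - (s : ℝ)) * M t + s * m t = (1 - (s' : ℝ)) * M t + s' * m t :=
        congrArg (fun z : unitSq => z.1.1) h
      have : ((s : ℝ) - s') * (m t - M t) = 0 := by linarith
      rcases mul_eq_zero.1 this with h3 | h3
      · rw [show s = s' from Subtype.ext (by linarith)]
      · exact absurd (by linarith) hd
  let G : unitSq → X := fun x => H (Function.surjInv sπ x)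
  have hG : ∀ st, G (π st) = H st := fun st => hfib _ _ (Function.surjInv_eq sπ (π st))
  have cG : Continuous G := qπ.continuous_iff.2 (by
    rw [show G ∘ π = H from funext hG]; exact H.continuous)
  refine ⟨fun x => G ⟨clampSq x, clampSq_mem x⟩, ?_, mapsTo_univ _ _, ?_⟩
  · exact (cG.comp (continuous_clampSq.subtype_mk _)).continuousOn
  · rintro ⟨x, y⟩ ⟨hxy, hbd⟩
    obtain ⟨⟨s, t⟩, hst⟩ := sπ ⟨(x, y), hxy⟩
    have e : (⟨clampSq (x, y), clampSq_mem _⟩ : unitSq) = π (s, t) := by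
      rw [hst]; exact Subtype.ext (clampSq_of_mem hxy)
    have key : ((s : ℝ) = 0 ∧ (x, y) = (M t, m t)) ∨ ((s : ℝ) = 1 ∧ (x, y) = (m t, M t)) ∨
        (m t = M t ∧ (x, y) = (m t, M t)) := by
      have hx : x = (1 - (s : ℝ)) * M t + s * m t := congrArg (fun z : unitSq => z.1.1) hst.symm
      have hy : y = (1 - (s : ℝ)) * m t + s * M t := congrArg (fun z : unitSq => z.1.2) hst.symm
      have hmt := (hm t t.2).1
      have hMt := (hM t t.2).2
      rcases (hle t t.2).eq_or_lt with h1 | h1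
      · refine Or.inr (Or.inr ⟨h1, Prod.ext ?_ ?_⟩)
        · simp only; rw [hx, h1]; ring
        · simp only; rw [hy, h1]; ring
      rcases s.2.1.eq_or_lt with h2 | h2
      · refine Or.inl ⟨h2.symm, Prod.ext ?_ ?_⟩
        · simp only; rw [hx, ← h2]; ring
        · simp only; rw [hy, ← h2]; ring
      rcases s.2.2.eq_or_lt with h3 | h3
      · refine Or.inr (Or.inl ⟨h3, Prod.ext ?_ ?_⟩)
        · simp only; rw [hx, h3]; ring
        · simp only; rw [hy, h3]; ring
      exfalso
      have k1 := mul_pos h2 (sub_pos.2 h1)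
      have k2 := mul_pos (sub_pos.2 h3) (sub_pos.2 h1)
      simp only at hbd
      rcases hbd with h | h | h | h <;> nlinarith
    simp only [e, hG]
    rcases key with ⟨hs, hk⟩ | ⟨hs, hk⟩ | ⟨hs, hk⟩
    · rw [hk, show s = 0 from Subtype.ext hs]
      exact H.apply_zero t
    · rw [hk, show s = 1 from Subtype.ext hs]
      exact H.apply_one t
    · rw [hk]
      rcases hdeg t t.2 hs with h0 | h1
      · rw [show t = 0 from Subtype.ext h0]; simp [M, m]
      · rw [show t = 1 from Subtype.ext h1]; norm_num [M, m]

theorem OneConnected.of_simplyConnectedSpace {X : Type*} [TopologicalSpace X] {S : Set X}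
    [SimplyConnectedSpace S] : OneConnected S :=
  .of_univ_subtype (.univ_of_simplyConnectedSpace S)

theorem Convex.oneConnected {E : Type*} [AddCommGroup E] [Module ℝ E] [TopologicalSpace E]
    [ContinuousAdd E] [ContinuousSMul ℝ E] {S : Set E} (hS : Convex ℝ S) (hne : S.Nonempty) :
    OneConnected S :=
  have := hS.contractibleSpace hne
  .of_simplyConnectedSpace

/-- The 3-sphere is 1-connected. -/
theorem oneConnected_sphere : OneConnected (univ : Set (Metric.sphere (0 : E4) 1)) := by
  have : Fact (Module.finrank ℝ E4 = 3 + 1) := ⟨by simp⟩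
  have hcompl : ∀ v : Metric.sphere (0 : E4) 1, OneConnected ({v}ᶜ : Set (Metric.sphere (0 : E4) 1)) := by
    intro v
    have h := stereographic'_source (E := E4) (n := 3) v
    have ht := stereographic'_target (E := E4) (n := 3) v
    refine (convex_univ.oneConnected univ_nonempty).of_retract (j := (stereographic' 3 v).symm)
      (k := stereographic' 3 v) ?_ ?_ ?_ (fun _ _ => mem_univ _) ?_
    · rw [← ht]; exact (stereographic' 3 v).continuousOn_symm
    · rw [← h]; exact (stereographic' 3 v).continuousOn
    · rw [← ht, ← h]; exact (stereographic' 3 v).mapsTo_symm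
    · intro z hz; rw [← h] at hz; exact (stereographic' 3 v).left_inv hz
  let v : Metric.sphere (0 : E4) 1 := ⟨EuclideanSpace.single 0 1, by simp⟩
  have hv : v ≠ -v := by
    intro h
    have := congrArg (fun w : Metric.sphere (0 : E4) 1 => (w : E4) 0) h
    simp [v] at this
    norm_num at this
  have hu : (univ : Set (Metric.sphere (0 : E4) 1)) = {v}ᶜ ∪ {-v}ᶜ := by
    ext z; simp only [mem_univ, mem_union, mem_compl_iff, mem_singleton_iff, true_iff]
    by_contra! hc
    exact hv (hc.1.symm.trans hc.2)
  rw [hu]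
  refine (hcompl v).union (hcompl (-v)) isOpen_compl_singleton isOpen_compl_singleton ?_
  have h := stereographic'_source (E := E4) (n := 3) v
  have ht := stereographic'_target (E := E4) (n := 3) v
  set φ := stereographic' 3 v
  have hmem : -v ∈ φ.source := by rw [h]; exact hv.symm
  -- Stereographic projection turns the twice punctured sphere into a punctured 3-space, which is
  -- path connected.
  have : {v}ᶜ ∩ {-v}ᶜ = φ.symm '' {φ (-v)}ᶜ := by
    ext z
    constructor
    · rintro ⟨h1, h2⟩
      rw [← h] at h1
      exact ⟨φ z, fun e => h2 (φ.injOn h1 hmem e), φ.left_inv h1⟩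
    · rintro ⟨y, hy, rfl⟩
      have hy' : y ∈ φ.target := by rw [ht]; trivial
      refine ⟨?_, fun e => hy ?_⟩
      · rw [← h]; exact φ.map_target hy'
      · rw [mem_singleton_iff] at e
        rw [mem_singleton_iff, ← e, φ.right_inv hy']
  rw [this]
  refine IsPathConnected.image' (isPathConnected_compl_singleton_of_one_lt_rank ?_ _) ?_
  · rw [← Module.finrank_eq_rank]; simp
  · exact φ.continuousOn_symm.mono (by rw [ht]; exact subset_univ _)

/-- Round shells in `ℝ⁴` are 1-connected. -/
theorem oneConnected_shell {a b : ℝ} (ha : 0 ≤ a) (hab : a < b) :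
    OneConnected {v : E4 | a < ‖v‖ ∧ ‖v‖ < b} := by
  have hI : OneConnected (Ioo a b) := (convex_Ioo a b).oneConnected (nonempty_Ioo.2 hab)
  obtain ⟨s₀⟩ : Nonempty (Metric.sphere (0 : E4) 1) := ⟨⟨EuclideanSpace.single 0 1, by simp⟩⟩
  have hmem : ∀ v : E4, a < ‖v‖ → ‖v‖⁻¹ • v ∈ Metric.sphere (0 : E4) 1 := fun v hv => by
    have : 0 < ‖v‖ := ha.trans_lt hv
    simp [norm_smul, this.ne']
  classical
  -- Polar coordinates. Inner radius `a = 0` is allowed and gives the punctured ball.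
  refine (oneConnected_sphere.prod hI).of_retract (j := fun q => q.2 • (q.1 : E4))
    (k := fun v => (if h : a < ‖v‖ then ⟨‖v‖⁻¹ • v, hmem v h⟩ else s₀, ‖v‖)) ?_ ?_ ?_ ?_ ?_
  · fun_prop
  · refine ContinuousOn.prodMk ?_ continuous_norm.continuousOn
    rw [IsInducing.subtypeVal.continuousOn_iff]
    refine ContinuousOn.congr (f := fun v => ‖v‖⁻¹ • v) ?_ fun v hv => by simp [hv.1]
    exact (continuous_norm.continuousOn.inv₀ fun v hv => (ha.trans_lt hv.1).ne').smul continuousOn_id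
  · rintro ⟨s, t⟩ ⟨-, ht⟩
    have : ‖t • (s : E4)‖ = t := by
      rw [norm_smul, norm_eq_of_mem_sphere, mul_one, Real.norm_of_nonneg (ha.trans ht.1.le)]
    simpa [this] using ht
  · rintro v hv
    exact ⟨mem_univ _, hv⟩
  · rintro v hv
    simp only [hv.1, dif_pos]
    exact smul_inv_smul₀ (ha.trans_lt hv.1).ne' v

/-! ### Approximate lifting over squares and cells -/

/-- The point `b` has arbitrarily small open neighbourhoods with 1-connected preimage. -/
def OneConnectedOver {Z B : Type*} [TopologicalSpace Z] [TopologicalSpace B] (p : Z → B) (b : B) :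
    Prop :=
  ∀ V ∈ 𝓝 b, ∃ U, IsOpen U ∧ b ∈ U ∧ U ⊆ V ∧ OneConnected (p ⁻¹' U)

section lift

variable {Z B : Type*} [TopologicalSpace Z] [MetricSpace B] {p : Z → B}

/-- A Lebesgue number for the cover by good neighbourhoods is uniform in `b`. The neighbourhood
found may be centred at another point `i`, and starting from radius `ε / 2` pays for this change of
centre. -/
theorem OneConnectedOver.uniform [CompactSpace B] (hp : ∀ b, OneConnectedOver p b) {ε : ℝ}
    (hε : 0 < ε) : ∃ η > 0, η ≤ ε ∧ ∀ b, ∃ U, Metric.ball b η ⊆ U ∧ U ⊆ Metric.ball b ε ∧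
      OneConnected (p ⁻¹' U) := by
  choose U oU bU hU sU using fun b => hp b _ (Metric.ball_mem_nhds b (half_pos hε))
  obtain ⟨η, hη, h⟩ := lebesgue_number_lemma_of_metric (isCompact_univ (X := B)) oU
    (fun b _ => mem_iUnion.2 ⟨b, bU b⟩)
  refine ⟨min η ε, lt_min hη hε, min_le_right _ _, fun b => ?_⟩
  obtain ⟨i, hi⟩ := h b (mem_univ _)
  refine ⟨U i, (Metric.ball_subset_ball (min_le_left _ _)).trans hi, fun x hx => ?_, sU i⟩
  have h1 := hU i hx
  have h2 := hU i (hi (Metric.mem_ball_self hη))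
  rw [Metric.mem_ball] at h1 h2 ⊢
  have := dist_triangle_right x b i
  linarith

/-- Approximate lifting over the unit square. -/
theorem exists_approx_lift [CompactSpace B] (hp : ∀ b, OneConnectedOver p b) {ε : ℝ} (hε : 0 < ε) :
    ∃ η > 0, ∀ F ⊆ unitSq, ∀ α : ℝ × ℝ → B, ContinuousOn α unitSq → ∀ β₀ : ℝ × ℝ → Z,
      ContinuousOn β₀ F → (∀ x ∈ F, dist (p (β₀ x)) (α x) < η) →
      ∃ β : ℝ × ℝ → Z, Continuous β ∧ (∀ x ∈ unitSq, dist (p (β x)) (α x) < ε) ∧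
        ((0, 0) ∈ F → β (0, 0) = β₀ (0, 0)) ∧ ((1, 0) ∈ F → β (1, 0) = β₀ (1, 0)) ∧
        (unitSqBd ⊆ F → EqOn β β₀ unitSqBd) := by
  -- Scales are chosen backwards: squares will live over `U₂`, within `ε / 2`; edges over `U₁`,
  -- within `η₂ / 2`; vertices within `η₁ / 2`. The remaining half at each scale absorbs the
  -- variation `τ` of the map on one grid square.
  obtain ⟨η₂, hη₂, -, h₂⟩ := OneConnectedOver.uniform hp (half_pos hε)
  choose U₂ bU₂ Ub₂ sU₂ using h₂
  obtain ⟨η₁, hη₁, η12, h₁⟩ := OneConnectedOver.uniform hp (half_pos hη₂)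
  choose U₁ bU₁ Ub₁ sU₁ using h₁
  obtain ⟨η₀, hη₀, -, h₀⟩ := OneConnectedOver.uniform hp (half_pos hη₁)
  refine ⟨η₁ / 2, half_pos hη₁, fun F hF α cα β₀ cβ₀ hβ₀ => ?_⟩
  obtain ⟨τ, hτ, t1, t2, t3⟩ : ∃ τ > 0, τ ≤ η₁ / 2 ∧ τ ≤ η₂ / 2 ∧ τ ≤ ε / 2 :=
    ⟨min (η₁ / 2) (min (η₂ / 2) (ε / 2)), by positivity, min_le_left _ _,
      (min_le_right _ _).trans (min_le_left _ _), (min_le_right _ _).trans (min_le_right _ _)⟩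
  have : Nonempty B := ⟨α 0⟩
  obtain ⟨N, hN, hb⟩ := exists_mesh_clampSq cα (c := fun b : B => Metric.ball b (τ / 2))
    (fun b => Metric.isOpen_ball) (fun x _ => ⟨α x, Metric.mem_ball_self (half_pos hτ)⟩)
  have hN' : (N : ℝ) ≠ 0 := by exact_mod_cast hN.ne'
  have hh : 0 < 1 / (N : ℝ) := by positivity
  set h : ℝ := 1 / (N : ℝ) with hdef
  set α' := α ∘ clampSq with hα'
  have eα' : ∀ x ∈ unitSq, α' x = α x := fun x hx => congrArg α (clampSq_of_mem hx)
  have near : ∀ i j, ∀ x ∈ gridQ h i j, ∀ y ∈ gridQ h i j, dist (α' x) (α' y) < τ := by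
    intro i j x hx y hy
    obtain ⟨b, hb⟩ := hb i j
    have h1 := Metric.mem_ball.1 (hb hx)
    have h2 := Metric.mem_ball.1 (hb hy)
    have := dist_triangle_right (α' x) (α' y) b
    linarith
  have Hs := gridH_subset hh
  have Ws := gridW_subset hh
  have PQ : ∀ i j, gridPt h i j ∈ gridQ h i j := fun i j => Hs i j (gridPt_mem_gridH hh i j)
  have hF' : ∀ x ∈ F, dist (p (β₀ x)) (α' x) < η₁ / 2 := fun x hx => by
    rw [eα' x (hF hx)]; exact hβ₀ x hx
  -- The set of each cell is centred at the image of its lower left corner, so passing from a face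
  -- to a larger cell may change the centre, at a cost below `τ`.
  have move₁ : ∀ i j, ∀ x ∈ gridQ h i j, ∀ z, dist (p z) (α' x) < η₁ / 2 →
      p z ∈ U₁ (α' (gridPt h i j)) := fun i j x hx z hz => bU₁ _ (by
    have := dist_triangle (p z) (α' x) (α' (gridPt h i j))
    have := near i j x hx _ (PQ i j)
    rw [Metric.mem_ball]; linarith)
  have move₂ : ∀ i j, ∀ x ∈ gridQ h i j, ∀ z, dist (p z) (α' x) < η₂ / 2 →
      p z ∈ U₂ (α' (gridPt h i j)) := fun i j x hx z hz => bU₂ _ (by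
    have := dist_triangle (p z) (α' x) (α' (gridPt h i j))
    have := near i j x hx _ (PQ i j)
    rw [Metric.mem_ball]; linarith)
  obtain ⟨β, cβ, mβ, eV, eH, eW⟩ := exists_grid_extension hh F β₀ cβ₀
    (fun i j => p ⁻¹' Metric.ball (α' (gridPt h i j)) (η₁ / 2))
    (fun i j => p ⁻¹' U₁ (α' (gridPt h i j))) (fun i j => p ⁻¹' U₁ (α' (gridPt h i j)))
    (fun i j => p ⁻¹' U₂ (α' (gridPt h i j)))
    (fun i j z hz => move₁ i j _ (PQ i j) z hz)
    (fun i j z hz => move₁ i j _ (Hs i j (gridPt_mem_gridH' hh i j)) z hz)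
    (fun i j z hz => move₁ i j _ (PQ i j) z hz)
    (fun i j z hz => move₁ i j _ (Ws i j (gridPt_mem_gridW' hh i j)) z hz)
    (fun i j z hz => move₂ i j _ (PQ i j) z (Ub₁ _ hz))
    (fun i j z hz => move₂ i j _ (Ws i j (gridPt_mem_gridW' hh i j)) z (Ub₁ _ hz))
    (fun i j z hz => move₂ i j _ (PQ i j) z (Ub₁ _ hz))
    (fun i j z hz => move₂ i j _ (Hs i j (gridPt_mem_gridH' hh i j)) z (Ub₁ _ hz))
    (fun i j hx => hF' _ hx)
    (fun i j hs x hx => move₁ i j _ (Hs i j hx) _ (hF' x (hs hx)))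
    (fun i j hs x hx => move₁ i j _ (Ws i j hx) _ (hF' x (hs hx)))
    (fun i j hs x hx => move₂ i j _ hx _ ((hF' x (hs hx)).trans_le (by linarith)))
    (fun i j _ => by
      obtain ⟨U, -, h1, h2⟩ := h₀ (α' (gridPt h i j))
      exact h2.1.nonempty.mono (preimage_mono h1))
    (fun i j _ => (sU₁ _).1) (fun i j _ => (sU₁ _).1) (fun i j _ => (sU₂ _).2)
  refine ⟨β, cβ, fun x hx => ?_, fun h0 => ?_, fun h1 => ?_, fun hbd => ?_⟩
  · have hxQ : x ∈ gridQ h ⌊x.1 / h⌋ ⌊x.2 / h⌋ :=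
      ⟨mem_gridIcc_floor hh x.1, mem_gridIcc_floor hh x.2⟩
    have k1 := Metric.mem_ball.1 (Ub₂ _ (mβ _ _ hxQ))
    have k2 := near _ _ _ (PQ _ _) x hxQ
    rw [← eα' x hx]
    have := dist_triangle (p (β x)) (α' (gridPt h ⌊x.1 / h⌋ ⌊x.2 / h⌋)) (α' x)
    linarith
  · have := eV 0 0
    rw [gridPt_zero] at this
    exact this h0
  · have := eV N 0
    rw [gridPt_one hN] at this
    exact this h1
  · exact eqOn_unitSqBd_of_edges hN (fun i j hs => eH i j (hs.trans hbd))
      (fun i j hs => eW i j (hs.trans hbd))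

/-- Maps of `n`-cells to `B` that are `η`-lifted on the boundary have relative `ε`-lifts. -/
def CellLift (p : Z → B) (n : ℕ) (ε η : ℝ) : Prop :=
  ∀ α : (Fin n → ℝ) → B, ContinuousOn α (Metric.closedBall 0 1) →
    ∀ g : (Fin n → ℝ) → Z, ContinuousOn g (Metric.sphere 0 1) →
      (∀ x ∈ Metric.sphere 0 1, dist (p (g x)) (α x) < η) →
      ∃ G : (Fin n → ℝ) → Z, ContinuousOn G (Metric.closedBall 0 1) ∧
        EqOn G g (Metric.sphere 0 1) ∧ ∀ x ∈ Metric.closedBall 0 1, dist (p (G x)) (α x) < ε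

/-- The unit sphere in dimension zero is empty, so only nonemptiness of a small preimage is needed.
-/
theorem CellLift.zero (hp : ∀ b, OneConnectedOver p b) {ε : ℝ} (hε : 0 < ε) (η : ℝ) :
    CellLift p 0 ε η := by
  intro α _ g _ _
  obtain ⟨U, -, -, h1, h2⟩ := hp (α 0) _ (Metric.ball_mem_nhds _ hε)
  obtain ⟨z, hz⟩ := h2.1.nonempty
  refine ⟨fun _ => z, continuousOn_const, fun x hx => ?_, fun x _ => ?_⟩
  · rw [Subsingleton.elim x 0, mem_sphere_zero_iff_norm, norm_zero] at hx
    exact absurd hx zero_ne_one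
  · rw [Subsingleton.elim x 0]; exact h1 hz

theorem norm_fin_one (x : Fin 1 → ℝ) : ‖x‖ = |x 0| := by
  rw [Pi.norm_def]; simp

/-- With the sup norm the model 2-cell is a square, so an affine change of coordinates reduces it to
`unitSq`. -/
theorem norm_fin_two (x : Fin 2 → ℝ) : ‖x‖ = max |x 0| |x 1| := by
  rw [Pi.norm_def]; simp [Fin.univ_succ]

/-- An interval is the bottom side of a square on which the data ignore the second coordinate;
values are prescribed only at the two lower corners. -/
theorem CellLift.one [CompactSpace B] (hp : ∀ b, OneConnectedOver p b) {ε : ℝ} (hε : 0 < ε) :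
    ∃ η > 0, CellLift p 1 ε η := by
  obtain ⟨η, hη, h⟩ := exists_approx_lift hp hε
  refine ⟨η, hη, fun α cα g cg hg => ?_⟩
  let k : ℝ × ℝ → (Fin 1 → ℝ) := fun q _ => 2 * q.1 - 1
  have ck : Continuous k := by fun_prop
  have mk : MapsTo k unitSq (Metric.closedBall 0 1) := fun q hq => by
    rw [mem_closedBall_zero_iff, norm_fin_one, abs_le]
    exact ⟨by simp only [k]; linarith [hq.1.1], by simp only [k]; linarith [hq.1.2]⟩
  let F : Set (ℝ × ℝ) := {(0, 0), (1, 0)}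
  have hF : F ⊆ unitSq := by
    rintro q (rfl | rfl) <;> simp [unitSq]
  have mF : MapsTo k F (Metric.sphere 0 1) := by
    rintro q (rfl | rfl) <;> rw [mem_sphere_zero_iff_norm, norm_fin_one] <;> norm_num [k]
  obtain ⟨β, cβ, hβ, e0, e1, -⟩ := h F hF (α ∘ k) (cα.comp ck.continuousOn mk) (g ∘ k)
    (cg.comp ck.continuousOn mF) (fun x hx => hg _ (mF hx))
  have hk : ∀ x : Fin 1 → ℝ, k ((x 0 + 1) / 2, 0) = x := fun x => by
    ext i; rw [Subsingleton.elim i 0]; simp only [k]; ring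
  refine ⟨fun x => β ((x 0 + 1) / 2, 0), Continuous.continuousOn (by fun_prop), fun x hx => ?_,
    fun x hx => ?_⟩
  · rw [mem_sphere_zero_iff_norm, norm_fin_one] at hx
    have e := hk x
    rcases eq_or_eq_neg_of_abs_eq hx with h' | h'
    · have h'' : (x 0 + 1) / 2 = 1 := by rw [h']; norm_num
      simp only [h''] at e ⊢
      rw [e1 (by simp [F]), Function.comp_apply, e]
    · have h'' : (x 0 + 1) / 2 = 0 := by rw [h']; norm_num
      simp only [h''] at e ⊢
      rw [e0 (by simp [F]), Function.comp_apply, e]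
  · rw [mem_closedBall_zero_iff, norm_fin_one, abs_le] at hx
    have := hβ ((x 0 + 1) / 2, 0) ⟨⟨by simp only; linarith, by simp only; linarith⟩, by simp⟩
    rwa [Function.comp_apply, hk] at this

theorem CellLift.two [CompactSpace B] (hp : ∀ b, OneConnectedOver p b) {ε : ℝ} (hε : 0 < ε) :
    ∃ η > 0, CellLift p 2 ε η := by
  obtain ⟨η, hη, h⟩ := exists_approx_lift hp hε
  refine ⟨η, hη, fun α cα g cg hg => ?_⟩
  let k : ℝ × ℝ → (Fin 2 → ℝ) := fun q => ![2 * q.1 - 1, 2 * q.2 - 1]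
  have ck : Continuous k := by fun_prop
  have mk : MapsTo k unitSq (Metric.closedBall 0 1) := fun q hq => by
    rw [mem_closedBall_zero_iff, norm_fin_two, max_le_iff, abs_le, abs_le]
    simp only [k, Matrix.cons_val_zero, Matrix.cons_val_one]
    exact ⟨⟨by linarith [hq.1.1], by linarith [hq.1.2]⟩,
      ⟨by linarith [hq.2.1], by linarith [hq.2.2]⟩⟩
  have mF : MapsTo k unitSqBd (Metric.sphere 0 1) := by
    rintro ⟨x, y⟩ ⟨hq, hbd⟩
    have hle := mem_closedBall_zero_iff.1 (mk hq)
    rw [mem_sphere_zero_iff_norm]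
    refine le_antisymm hle ?_
    rw [norm_fin_two, le_max_iff]
    simp only [k, Matrix.cons_val_zero, Matrix.cons_val_one]
    simp only at hbd
    rcases hbd with rfl | rfl | rfl | rfl <;> norm_num
  obtain ⟨β, cβ, hβ, -, -, eβ⟩ := h unitSqBd unitSqBd_subset (α ∘ k) (cα.comp ck.continuousOn mk)
    (g ∘ k) (cg.comp ck.continuousOn mF) (fun x hx => hg _ (mF hx))
  have hk : ∀ x : Fin 2 → ℝ, k ((x 0 + 1) / 2, (x 1 + 1) / 2) = x := fun x => by
    ext i; fin_cases i <;> simp [k] <;> ring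
  have mi : ∀ x ∈ Metric.closedBall (0 : Fin 2 → ℝ) 1,
      (((x 0 + 1) / 2, (x 1 + 1) / 2) : ℝ × ℝ) ∈ unitSq := fun x hx => by
    rw [mem_closedBall_zero_iff, norm_fin_two, max_le_iff, abs_le, abs_le] at hx
    exact ⟨⟨by simp only; linarith, by simp only; linarith⟩,
      ⟨by simp only; linarith, by simp only; linarith⟩⟩
  refine ⟨fun x => β ((x 0 + 1) / 2, (x 1 + 1) / 2), Continuous.continuousOn (by fun_prop),
    fun x hx => ?_, fun x hx => ?_⟩
  · have : (((x 0 + 1) / 2, (x 1 + 1) / 2) : ℝ × ℝ) ∈ unitSqBd := by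
      refine ⟨mi x (Metric.sphere_subset_closedBall hx), ?_⟩
      rw [mem_sphere_zero_iff_norm, norm_fin_two] at hx
      simp only
      rcases max_choice |x 0| |x 1| with h' | h' <;> rw [h'] at hx <;>
        rcases eq_or_eq_neg_of_abs_eq hx with h'' | h'' <;> rw [h''] <;> norm_num
    simp only [eβ subset_rfl this, Function.comp_apply, hk]
  · have := hβ _ (mi x hx)
    rwa [Function.comp_apply, hk] at this

end lift

/-! ### Lifting over CW complexes, skeleton by skeleton -/

section cw

open RelCWComplex

variable {K : Type*} [TopologicalSpace K] [T2Space K] [CWComplex (univ : Set K)]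

/-- The characteristic map goes from a compact ball to a Hausdorff space, hence is closed, and the
closed cell has the quotient topology. -/
theorem continuousOn_closedCell_of_comp {X : Type*} [TopologicalSpace X] {n : ℕ}
    (e : cell (univ : Set K) n) {f : K → X}
    (hf : ContinuousOn (f ∘ map n e) (Metric.closedBall 0 1)) :
    ContinuousOn f (closedCell n e) := by
  rw [continuousOn_iff_isClosed]
  intro t ht
  refine ⟨map n e '' (Metric.closedBall 0 1 ∩ (f ∘ map n e) ⁻¹' t), ?_, ?_⟩
  · refine IsCompact.isClosed (IsCompact.image_of_continuousOn ?_ ((continuousOn n e).mono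
      inter_subset_left))
    exact (isCompact_closedBall _ _).of_isClosed_subset
      (hf.preimage_isClosed_of_isClosed Metric.isClosed_closedBall ht) inter_subset_left
  · ext u
    constructor
    · rintro ⟨h1, x, hx, rfl⟩
      exact ⟨⟨x, ⟨hx, h1⟩, rfl⟩, x, hx, rfl⟩
    · rintro ⟨⟨x, ⟨hx, h1⟩, rfl⟩, h2⟩
      exact ⟨h1, h2⟩

theorem continuous_of_closedCell {X : Type*} [TopologicalSpace X] {f : K → X}
    (hf : ∀ n (e : cell (univ : Set K) n), ContinuousOn f (closedCell n e)) : Continuous f := by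
  refine continuous_iff_isClosed.2 fun t ht => ?_
  rw [CWComplex.closed univ _ (subset_univ _)]
  intro n e
  rw [inter_comm]
  exact (hf n e).preimage_isClosed_of_isClosed isClosed_closedCell ht

/-- A finite closed cover permits cellwise checking. By closure finiteness the boundary of an
`n`-cell lands in such a union, so a lift on the lower cells is continuous along the attaching map.
-/
theorem continuousOn_iUnion_closedCell {X : Type*} [TopologicalSpace X] {f : K → X} {n : ℕ}
    (I : Π m, Finset (cell (univ : Set K) m))
    (hf : ∀ m < n, ∀ e : cell (univ : Set K) m, ContinuousOn f (closedCell m e)) :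
    ContinuousOn f (⋃ (m < n) (j ∈ I m), map m j '' Metric.closedBall 0 1) := by
  have : (⋃ (m < n) (j ∈ I m), map m j '' Metric.closedBall 0 1) =
      ⋃ q : (Σ m : Fin n, I m), closedCell (C := (univ : Set K)) q.1 q.2.1 := by
    ext u
    simp only [mem_iUnion, closedCell]
    constructor
    · rintro ⟨m, hm, j, hj, h⟩
      exact ⟨⟨⟨m, hm⟩, ⟨j, hj⟩⟩, h⟩
    · rintro ⟨⟨⟨m, hm⟩, ⟨j, hj⟩⟩, h⟩
      exact ⟨m, hm, j, hj, h⟩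
  rw [this]
  exact (locallyFinite_of_finite _).continuousOn_iUnion (fun _ => isClosed_closedCell)
    fun q => hf _ q.1.2 _

variable {X B : Type*} [TopologicalSpace X] [MetricSpace B] {p : X → B}

/-- A lift, up to `ε`, of a map `α : K → B` over the cells of dimension less than `n`. -/
structure IsSkeletonLift (p : X → B) (α : C(K, B)) (K₀ : Subcomplex (univ : Set K))
    (α₀ : C((K₀ : Set K), X)) (n : ℕ) (ε : ℝ) (β : K → X) : Prop where
  extends_base : ∀ u : (K₀ : Set K), β u = α₀ u
  continuousOn_cell : ∀ m < n, ∀ e : cell (univ : Set K) m, ContinuousOn β (closedCell m e)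
  dist_lt : ∀ m < n, ∀ e : cell (univ : Set K) m, ∀ u ∈ closedCell m e, dist (p (β u)) (α u) < ε

/-- Only open `n`-cells outside `K₀` receive new values. They are disjoint from `K₀` and from all
lower closed cells, so earlier choices survive; `CellLift` turns boundary error `η` into error `ε`.
On cells of `K₀` the lift is exact. -/
theorem IsSkeletonLift.succ {α : C(K, B)} {K₀ : Subcomplex (univ : Set K)}
    {α₀ : C((K₀ : Set K), X)} (hα₀ : ∀ u : (K₀ : Set K), p (α₀ u) = α u) {n : ℕ} {ε η : ℝ}
    (hε : 0 < ε) (hηε : η ≤ ε) {β : K → X} (hβ : IsSkeletonLift p α K₀ α₀ n η β)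
    (hlift : CellLift p n ε η) : ∃ β' : K → X, IsSkeletonLift p α K₀ α₀ (n + 1) ε β' := by
  classical
  have exG : ∀ e : cell (univ : Set K) n, ∃ G : (Fin n → ℝ) → X,
      ContinuousOn G (Metric.closedBall 0 1) ∧
        EqOn G (β ∘ map n e) (Metric.sphere 0 1) ∧
        ∀ x ∈ Metric.closedBall 0 1, dist (p (G x)) (α (map n e x)) < ε := by
    intro e
    obtain ⟨I, hI⟩ := CWComplex.mapsTo n e
    refine hlift (α ∘ map n e) (α.continuous.comp_continuousOn (continuousOn n e)) (β ∘ map n e)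
      ((continuousOn_iUnion_closedCell I hβ.2).comp
        ((continuousOn n e).mono Metric.sphere_subset_closedBall) hI) fun x hx => ?_
    have := hI hx
    simp only [mem_iUnion] at this
    obtain ⟨m, hm, j, -, hu⟩ := this
    exact hβ.3 m hm j _ hu
  choose G cG eG dG using exG
  let β' : K → X := fun u => if u ∈ (K₀ : Set K) then β u else
    if h : ∃ e : cell (univ : Set K) n, u ∈ openCell n e then G h.choose ((map n h.choose).symm u)
    else β u
  have on_base : ∀ u ∈ (K₀ : Set K), β' u = β u := fun u hu => if_pos hu
  have on_lower : ∀ m < n, ∀ e : cell (univ : Set K) m, EqOn β' β (closedCell m e) := by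
    intro m hm e u hu
    simp only [β']
    split_ifs with h1 h2
    · rfl
    · obtain ⟨e', he'⟩ := h2
      refine absurd he' (disjoint_left.1 (CWComplex.disjoint_skeletonLT_openCell
        (C := (univ : Set K)) (n := ((m + 1 : ℕ) : ℕ∞)) (by exact_mod_cast hm)) ?_)
      have := CWComplex.closedCell_subset_skeletonLT (C := (univ : Set K)) m e hu
      exact_mod_cast this
    · rfl
  have on_new : ∀ e : cell (univ : Set K) n, e ∉ K₀.I n →
      EqOn (β' ∘ map n e) (G e) (Metric.closedBall 0 1) := by
    intro e he x hx
    rw [← Metric.sphere_union_ball] at hx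
    rcases hx with hx | hx
    · rw [eG e hx]
      obtain ⟨I, hI⟩ := CWComplex.mapsTo n e
      have := hI hx
      simp only [mem_iUnion] at this
      obtain ⟨m, hm, j, -, hu⟩ := this
      exact on_lower m hm j hu
    · have hu : map n e x ∈ openCell n e := mem_image_of_mem _ hx
      have h1 : map n e x ∉ (K₀ : Set K) := fun h =>
        disjoint_left.1 (CWComplex.Subcomplex.disjoint_openCell_subcomplex_of_not_mem K₀ he) hu h
      have h2 : ∃ e' : cell (univ : Set K) n, map n e x ∈ openCell n e' := ⟨e, hu⟩
      have h3 : h2.choose = e := by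
        have := CWComplex.eq_of_not_disjoint_openCell
          (not_disjoint_iff.2 ⟨_, h2.choose_spec, hu⟩)
        exact eq_of_heq (Sigma.mk.inj this).2
      simp only [Function.comp_apply, β', if_neg h1, dif_pos h2]
      rw [h3, (map n e).left_inv (by rw [source_eq]; exact hx)]
  refine ⟨β', fun u => (on_base u u.2).trans (hβ.1 u), fun m hm e => ?_, fun m hm e u hu => ?_⟩
  · rcases (Nat.lt_succ_iff.1 hm).lt_or_eq with h | rfl
    · exact (hβ.2 m h e).congr (on_lower m h e)
    · by_cases he : e ∈ K₀.I m
      · have hs := CWComplex.Subcomplex.closedCell_subset_of_mem K₀ he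
        refine ContinuousOn.mono ?_ hs
        rw [continuousOn_iff_continuous_domRestrict]
        convert α₀.continuous using 1
        funext u
        exact (on_base u u.2).trans (hβ.1 u)
      · exact continuousOn_closedCell_of_comp e ((cG e).congr (on_new e he))
  · rcases (Nat.lt_succ_iff.1 hm).lt_or_eq with h | rfl
    · rw [on_lower m h e hu]
      exact (hβ.3 m h e u hu).trans_le hηε
    · by_cases he : e ∈ K₀.I m
      · have hs := CWComplex.Subcomplex.closedCell_subset_of_mem K₀ he hu
        rw [on_base u hs, hβ.1 ⟨u, hs⟩, hα₀ ⟨u, hs⟩, dist_self]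
        exact hε
      · obtain ⟨x, hx, rfl⟩ := hu
        have := on_new e he hx
        rw [Function.comp_apply] at this
        rw [this]
        exact dG e x hx

theorem isUV1Delta_of_oneConnectedOver {X : Type u} {B : Type v} [TopologicalSpace X]
    [MetricSpace B] [CompactSpace B] {p : X → B} (hp : ∀ b, OneConnectedOver p b) {δ : ℝ}
    (hδ : 0 < δ) : IsUV1Delta.{w, u, v} δ p := by
  classical
  intro K _ _ _ hdim K₀ α₀ α hα₀
  -- The tolerance for each skeleton is fixed by what the next dimension accepts. The minima also
  -- keep the tolerances increasing, so that cells already lifted remain good enough.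
  obtain ⟨η₂, hη₂, L₂⟩ := CellLift.two hp hδ
  obtain ⟨η₁, hη₁, L₁⟩ := CellLift.one hp (lt_min hη₂ hδ)
  rcases isEmpty_or_nonempty K with hK | ⟨⟨u₀⟩⟩
  · exact ⟨⟨fun u => (hK.false u).elim, continuous_of_const fun u => (hK.false u).elim⟩,
      fun u => (hK.false u.1).elim, fun u => (hK.false u).elim⟩
  obtain ⟨U, -, -, -, hU⟩ := hp (α u₀) _ univ_mem
  obtain ⟨x₀, -⟩ := hU.1.nonempty
  have S₀ : IsSkeletonLift p α K₀ α₀ 0 (min η₁ (min η₂ δ))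
      (fun u => if h : u ∈ (K₀ : Set K) then α₀ ⟨u, h⟩ else x₀) :=
    ⟨fun u => dif_pos u.2, fun m hm => absurd hm (Nat.not_lt_zero m),
      fun m hm => absurd hm (Nat.not_lt_zero m)⟩
  obtain ⟨β₁, S₁⟩ := S₀.succ hα₀ (lt_min hη₁ (lt_min hη₂ hδ)) le_rfl
    (CellLift.zero hp (lt_min hη₁ (lt_min hη₂ hδ)) _)
  obtain ⟨β₂, S₂⟩ := S₁.succ hα₀ (lt_min hη₂ hδ) (min_le_right _ _)
    (fun a ca g cg hg => L₁ a ca g cg fun x hx => (hg x hx).trans_le (min_le_left _ _))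
  obtain ⟨β₃, S₃⟩ := S₂.succ hα₀ hδ (min_le_right _ _)
    (fun a ca g cg hg => L₂ a ca g cg fun x hx => (hg x hx).trans_le (min_le_left _ _))
  have hlt : ∀ n, cell (univ : Set K) n → n < 3 := fun n e => by
    by_contra! h
    exact (hdim n (by omega)).false e
  refine ⟨⟨β₃, continuous_of_closedCell fun n e => S₃.2 n (hlt n e) e⟩, S₃.1, fun u => ?_⟩
  have hu : u ∈ (univ : Set K) := mem_univ u
  rw [← CWComplex.union (C := (univ : Set K))] at hu
  simp only [mem_iUnion] at hu
  obtain ⟨n, e, hu⟩ := hu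
  exact S₃.3 n (hlt n e) e u hu

end cw

theorem isUV1_of_oneConnectedOver {X : Type u} {B : Type v} [TopologicalSpace X]
    [TopologicalSpace B] [CompactSpace B] {p : X → B} (cp : Continuous p)
    (hp : ∀ b, OneConnectedOver p b) : IsUV1.{w, u, v} p := by
  refine ⟨cp, fun m hm δ hδ => ?_⟩
  subst hm
  exact isUV1Delta_of_oneConnectedOver hp hδ

/-! ### Radial maps -/

/-- The extension of `CollaredDisc.radial` by the identity outside the ball of radius `2`. -/
noncomputable def squeezeE4 (v : E4) : E4 := min (2 * max (‖v‖ - 1) 0 / max ‖v‖ 1) 1 • v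

/-- The inverse of `squeezeE4`, from the punctured space to the exterior of the closed ball. -/
noncomputable def expandE4 (v : E4) : E4 := max ((‖v‖ / 2 + 1) / ‖v‖) 1 • v

/-- The reflection in the unit sphere that sends the radius `r` to `2 - r`. -/
noncomputable def reflectE4 (v : E4) : E4 := ((2 - ‖v‖) / ‖v‖) • v

/-- The denominator `max ‖v‖ 1` never vanishes, and it replaces `‖v‖` only where the numerator is
zero. -/
theorem continuous_squeezeE4 : Continuous squeezeE4 := by
  unfold squeezeE4
  have h : ∀ v : E4, max ‖v‖ 1 ≠ 0 := fun v => (zero_lt_one.trans_le (le_max_right _ _)).ne'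
  fun_prop (disch := assumption)

theorem continuousAt_expandE4 {v : E4} (hv : v ≠ 0) : ContinuousAt expandE4 v := by
  unfold expandE4
  have : ‖v‖ ≠ 0 := norm_ne_zero_iff.2 hv
  fun_prop (disch := assumption)

theorem continuousAt_reflectE4 {v : E4} (hv : v ≠ 0) : ContinuousAt reflectE4 v := by
  unfold reflectE4
  have : ‖v‖ ≠ 0 := norm_ne_zero_iff.2 hv
  fun_prop (disch := assumption)

theorem squeezeE4_of_le_two {v : E4} (hv : ‖v‖ ≤ 2) : squeezeE4 v = CollaredDisc.radial v := by
  unfold squeezeE4 CollaredDisc.radial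
  congr 1
  rcases le_total ‖v‖ 1 with h | h
  · rw [max_eq_right (by linarith : ‖v‖ - 1 ≤ 0)]; simp
  · rw [max_eq_left h, min_eq_left]
    rw [max_eq_left (by linarith), div_le_one (by linarith)]
    linarith

theorem squeezeE4_of_two_lt {v : E4} (hv : 2 < ‖v‖) : squeezeE4 v = v := by
  unfold squeezeE4
  rw [min_eq_right, one_smul]
  rw [max_eq_left (by linarith), max_eq_left (by linarith), le_div_iff₀ (by linarith)]
  linarith

theorem expandE4_of_two_lt {v : E4} (hv : 2 < ‖v‖) : expandE4 v = v := by
  unfold expandE4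
  rw [max_eq_right, one_smul]
  rw [div_le_one (by linarith)]
  linarith

theorem squeezeE4_of_le_one {v : E4} (hv : ‖v‖ ≤ 1) : squeezeE4 v = 0 := by
  unfold squeezeE4
  rw [max_eq_right (by linarith : ‖v‖ - 1 ≤ 0)]; simp

theorem norm_squeezeE4 {v : E4} (hv : 1 ≤ ‖v‖) : ‖squeezeE4 v‖ = min (2 * (‖v‖ - 1)) ‖v‖ := by
  have h0 : 0 < ‖v‖ := by linarith
  unfold squeezeE4
  rw [max_eq_left (by linarith), max_eq_left hv, norm_smul, Real.norm_of_nonneg, min_mul_of_nonneg _ _ h0.le,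
    div_mul_cancel₀ _ h0.ne', one_mul]
  exact le_min (div_nonneg (by linarith) h0.le) zero_le_one

/-- Squeezing doubles distances to the unit sphere up to radius two, hence the halved widths `δ / 2`
of the bicollars below. -/
theorem norm_squeezeE4_lt_iff {v : E4} (hv : 1 ≤ ‖v‖) {δ : ℝ} (hδ : δ ≤ 2) :
    ‖squeezeE4 v‖ < δ ↔ ‖v‖ < 1 + δ / 2 := by
  rw [norm_squeezeE4 hv, min_lt_iff]
  constructor
  · rintro (h | h) <;> linarith
  · intro h; left; linarith

theorem norm_expandE4 {v : E4} (hv : v ≠ 0) : ‖expandE4 v‖ = max (‖v‖ / 2 + 1) ‖v‖ := by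
  have h0 : 0 < ‖v‖ := norm_pos_iff.2 hv
  unfold expandE4
  rw [norm_smul, Real.norm_of_nonneg, max_mul_of_nonneg _ _ h0.le, div_mul_cancel₀ _ h0.ne', one_mul]
  exact le_max_of_le_right zero_le_one

theorem one_lt_norm_expandE4 {v : E4} (hv : v ≠ 0) : 1 < ‖expandE4 v‖ := by
  rw [norm_expandE4 hv]
  exact lt_max_of_lt_left (by linarith [norm_pos_iff.2 hv])

theorem squeezeE4_expandE4 {v : E4} (hv : v ≠ 0) : squeezeE4 (expandE4 v) = v := by
  have h0 : 0 < ‖v‖ := norm_pos_iff.2 hv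
  rcases lt_or_ge 2 ‖v‖ with h | h
  · rw [expandE4_of_two_lt h, squeezeE4_of_two_lt h]
  · have hn : ‖expandE4 v‖ = ‖v‖ / 2 + 1 := by
      rw [norm_expandE4 hv, max_eq_left (by linarith)]
    have he : expandE4 v = ((‖v‖ / 2 + 1) / ‖v‖) • v := by
      unfold expandE4
      rw [max_eq_left]
      rw [le_div_iff₀ h0]; linarith
    rw [squeezeE4_of_le_two (by rw [hn]; linarith), CollaredDisc.radial, hn, he, smul_smul,
      max_eq_left (by linarith)]
    have : 2 * (‖v‖ / 2 + 1 - 1) / (‖v‖ / 2 + 1) * ((‖v‖ / 2 + 1) / ‖v‖) = 1 := by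
      field_simp
      ring
    rw [this, one_smul]

theorem expandE4_squeezeE4 {v : E4} (hv : 1 < ‖v‖) : expandE4 (squeezeE4 v) = v := by
  have h0 : 0 < ‖v‖ := by linarith
  rcases lt_or_ge 2 ‖v‖ with h | h
  · rw [squeezeE4_of_two_lt h, expandE4_of_two_lt h]
  · have hn : ‖squeezeE4 v‖ = 2 * (‖v‖ - 1) := by
      rw [norm_squeezeE4 hv.le, min_eq_left (by linarith)]
    have hs : squeezeE4 v = (2 * (‖v‖ - 1) / ‖v‖) • v := by
      rw [squeezeE4_of_le_two h, CollaredDisc.radial, max_eq_left (by linarith)]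
    have h1 : 0 < ‖v‖ - 1 := by linarith
    unfold expandE4
    rw [hn, max_eq_left (by rw [le_div_iff₀ (by linarith)]; linarith), hs, smul_smul]
    have : (2 * (‖v‖ - 1) / 2 + 1) / (2 * (‖v‖ - 1)) * (2 * (‖v‖ - 1) / ‖v‖) = 1 := by
      field_simp
      ring
    rw [this, one_smul]

theorem squeezeE4_ne_zero_iff {v : E4} : squeezeE4 v ≠ 0 ↔ 1 < ‖v‖ := by
  constructor
  · intro h
    by_contra! h'
    exact h (squeezeE4_of_le_one h')
  · intro h
    rw [← norm_pos_iff, norm_squeezeE4 h.le]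
    exact lt_min (by linarith) (by linarith)

theorem norm_reflectE4 {v : E4} (hv : v ≠ 0) (h2 : ‖v‖ ≤ 2) : ‖reflectE4 v‖ = 2 - ‖v‖ := by
  have h0 : 0 < ‖v‖ := norm_pos_iff.2 hv
  rw [reflectE4, norm_smul, Real.norm_of_nonneg (div_nonneg (by linarith) h0.le),
    div_mul_cancel₀ _ h0.ne']

theorem reflectE4_reflectE4 {v : E4} (hv : v ≠ 0) (h2 : ‖v‖ < 2) :
    reflectE4 (reflectE4 v) = v := by
  have h0 : 0 < ‖v‖ := norm_pos_iff.2 hv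
  have h1 : 0 < 2 - ‖v‖ := by linarith
  conv_lhs => rw [reflectE4, norm_reflectE4 hv h2.le, reflectE4, smul_smul]
  have : (2 - (2 - ‖v‖)) / (2 - ‖v‖) * ((2 - ‖v‖) / ‖v‖) = 1 := by field_simp; ring
  rw [this, one_smul]

theorem reflectE4_of_norm_eq_one {v : E4} (hv : ‖v‖ = 1) : reflectE4 v = v := by
  rw [reflectE4, hv]; norm_num

/-! ### Radial maps transported to a collared disc -/

namespace CollaredDisc

variable {X : Type*} [TopologicalSpace X] (e : CollaredDisc X)

theorem injective : Function.Injective e.toFun := e.isOpenEmbedding.injective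

/-- The coordinates of the disc. -/
noncomputable def coord : X → E4 := Function.invFun e.toFun

@[simp] theorem coord_apply (v : E4) : e.coord (e.toFun v) = v :=
  Function.leftInverse_invFun e.injective v

theorem continuousAt_coord (v : E4) : ContinuousAt e.coord (e.toFun v) := by
  rw [← e.isOpenEmbedding.continuousAt_iff]
  have : e.coord ∘ e.toFun = id := funext e.coord_apply
  rw [this]
  exact continuousAt_id

open Classical in
/-- The self-map of `X` given by `φ` on the image of `ℝ⁴` and by the identity elsewhere. -/
noncomputable def push (φ : E4 → E4) (x : X) : X :=
  if x ∈ range e.toFun then e.toFun (φ (e.coord x)) else x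

theorem push_apply (φ : E4 → E4) (v : E4) : e.push φ (e.toFun v) = e.toFun (φ v) := by
  rw [push, if_pos (mem_range_self v), coord_apply]

theorem push_of_notMem (φ : E4 → E4) {x : X} (hx : x ∉ range e.toFun) : e.push φ x = x := if_neg hx

theorem continuousAt_push_apply {φ : E4 → E4} {v : E4} (hφ : ContinuousAt φ v) :
    ContinuousAt (e.push φ) (e.toFun v) := by
  rw [← e.isOpenEmbedding.continuousAt_iff]
  have : e.push φ ∘ e.toFun = e.toFun ∘ φ := funext (e.push_apply φ)
  rw [this]
  exact e.isOpenEmbedding.continuous.continuousAt.comp hφ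

/-- The image of the ball of radius two is compact, hence closed, and the map is the identity on its
complement, a neighbourhood of `x`. -/
theorem continuousAt_push_of_notMem [T2Space X] {φ : E4 → E4} (hφ : ∀ v, 2 < ‖v‖ → φ v = v) {x : X}
    (hx : x ∉ range e.toFun) : ContinuousAt (e.push φ) x := by
  have hcl : IsClosed (e.toFun '' Metric.closedBall 0 2) :=
    ((isCompact_closedBall _ _).image e.isOpenEmbedding.continuous).isClosed
  have hx' : x ∈ (e.toFun '' Metric.closedBall 0 2)ᶜ := fun ⟨v, _, hv⟩ => hx ⟨v, hv⟩
  refine continuousAt_id.congr ?_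
  filter_upwards [hcl.isOpen_compl.mem_nhds hx'] with y hy
  by_cases h : y ∈ range e.toFun
  · obtain ⟨v, rfl⟩ := h
    rw [push_apply, hφ v, id]
    by_contra! hv
    exact hy ⟨v, mem_closedBall_zero_iff.2 hv, rfl⟩
  · rw [push_of_notMem _ _ h, id]

/-- One formula on the whole chart makes continuity visible across the sphere of radius two, where
the definition of `squeeze` changes case. -/
theorem squeeze_eq_push : e.squeeze = e.push squeezeE4 := by
  funext x
  by_cases h : x ∈ range e.toFun
  · obtain ⟨v, rfl⟩ := h
    rw [push_apply, squeeze]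
    by_cases hv : ‖v‖ ≤ 2
    · have h : ∃ w : E4, ‖w‖ ≤ 2 ∧ e.toFun w = e.toFun v := ⟨v, hv, rfl⟩
      rw [dif_pos h, e.injective h.choose_spec.2, squeezeE4_of_le_two hv]
    · rw [dif_neg, squeezeE4_of_two_lt (not_le.1 hv)]
      rintro ⟨w, hw, h⟩
      exact hv (e.injective h ▸ hw)
  · rw [push_of_notMem _ _ h, squeeze, dif_neg]
    rintro ⟨w, -, hw⟩
    exact h ⟨w, hw⟩

theorem squeeze_apply (v : E4) : e.squeeze (e.toFun v) = e.toFun (squeezeE4 v) := by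
  rw [squeeze_eq_push, push_apply]

theorem squeeze_of_notMem {x : X} (hx : x ∉ range e.toFun) : e.squeeze x = x := by
  rw [squeeze_eq_push, push_of_notMem _ _ hx]

theorem continuous_squeeze [T2Space X] : Continuous e.squeeze := by
  rw [squeeze_eq_push, continuous_iff_continuousAt]
  intro x
  by_cases h : x ∈ range e.toFun
  · obtain ⟨v, rfl⟩ := h
    exact e.continuousAt_push_apply continuous_squeezeE4.continuousAt
  · exact e.continuousAt_push_of_notMem (fun v => squeezeE4_of_two_lt) h

theorem continuousAt_push_expandE4 [T2Space X] {x : X} (hx : x ≠ e.center) :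
    ContinuousAt (e.push expandE4) x := by
  by_cases h : x ∈ range e.toFun
  · obtain ⟨v, rfl⟩ := h
    exact e.continuousAt_push_apply (continuousAt_expandE4 fun h => hx (by rw [h]; rfl))
  · exact e.continuousAt_push_of_notMem (fun v => expandE4_of_two_lt) h

theorem push_expandE4_notMem {x : X} (hx : x ≠ e.center) :
    e.push expandE4 x ∉ e.toFun '' Metric.closedBall 0 1 := by
  rintro ⟨w, hw, hwx⟩
  by_cases h : x ∈ range e.toFun
  · obtain ⟨v, rfl⟩ := h
    rw [push_apply] at hwx
    rw [e.injective hwx, mem_closedBall_zero_iff] at hw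
    exact not_lt.2 hw (one_lt_norm_expandE4 fun h => hx (by rw [h]; rfl))
  · rw [push_of_notMem _ _ h] at hwx
    exact h ⟨w, hwx⟩

theorem squeeze_push_expandE4 {x : X} (hx : x ≠ e.center) : e.squeeze (e.push expandE4 x) = x := by
  by_cases h : x ∈ range e.toFun
  · obtain ⟨v, rfl⟩ := h
    rw [push_apply, squeeze_apply, squeezeE4_expandE4 fun h => hx (by rw [h]; rfl)]
  · rw [push_of_notMem _ _ h, squeeze_of_notMem _ h]

theorem push_expandE4_squeeze {x : X} (hx : e.squeeze x ≠ e.center) :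
    e.push expandE4 (e.squeeze x) = x := by
  by_cases h : x ∈ range e.toFun
  · obtain ⟨v, rfl⟩ := h
    rw [squeeze_apply] at hx ⊢
    rw [push_apply, expandE4_squeezeE4]
    exact squeezeE4_ne_zero_iff.1 fun h => hx (by rw [h]; rfl)
  · rw [squeeze_of_notMem _ h, push_of_notMem _ _ h]

theorem notMem_ball {v : E4} (hv : 1 ≤ ‖v‖) : e.toFun v ∉ e.toFun '' Metric.ball 0 1 := by
  rintro ⟨w, hw, h⟩
  rw [e.injective h, mem_ball_zero_iff] at hw
  linarith

theorem exists_of_squeeze_mem {a : X} (ha : a ∉ e.toFun '' Metric.ball 0 1) {δ : ℝ} (hδ : δ ≤ 2)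
    (h : e.squeeze a ∈ e.toFun '' Metric.ball 0 δ) :
    ∃ v, e.toFun v = a ∧ 1 ≤ ‖v‖ ∧ ‖v‖ < 1 + δ / 2 := by
  obtain ⟨w, hw, hwa⟩ := h
  by_cases hr : a ∈ range e.toFun
  · obtain ⟨v, rfl⟩ := hr
    have h1 : 1 ≤ ‖v‖ := by
      by_contra! hc
      exact ha ⟨v, mem_ball_zero_iff.2 hc, rfl⟩
    rw [squeeze_apply] at hwa
    rw [e.injective hwa, mem_ball_zero_iff, norm_squeezeE4_lt_iff h1 hδ] at hw
    exact ⟨v, rfl, h1, hw⟩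
  · rw [squeeze_of_notMem _ hr] at hwa
    exact absurd ⟨w, hwa⟩ hr

theorem squeeze_mem {v : E4} (h1 : 1 ≤ ‖v‖) {δ : ℝ} (hδ : δ ≤ 2) (hv : ‖v‖ < 1 + δ / 2) :
    e.squeeze (e.toFun v) ∈ e.toFun '' Metric.ball 0 δ := by
  rw [squeeze_apply]
  exact ⟨_, mem_ball_zero_iff.2 ((norm_squeezeE4_lt_iff h1 hδ).2 hv), rfl⟩

open Classical in
/-- A retraction of `X` to the exterior of the disc; its values on the disc are irrelevant. -/
noncomputable def toExterior (x : X) : e.Exterior :=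
  if h : x ∉ e.toFun '' Metric.ball 0 1 then ⟨x, h⟩ else
    ⟨e.toFun (EuclideanSpace.single 0 1), e.notMem_ball (by simp)⟩

theorem toExterior_of_notMem {x : X} (h : x ∉ e.toFun '' Metric.ball 0 1) :
    e.toExterior x = ⟨x, h⟩ := dif_pos h

theorem toExterior_val (a : e.Exterior) : e.toExterior a.1 = a := e.toExterior_of_notMem a.2

theorem continuousOn_toExterior : ContinuousOn e.toExterior (e.toFun '' Metric.ball 0 1)ᶜ := by
  have : IsInducing (fun a : e.Exterior => a.1) := ⟨rfl⟩
  rw [this.continuousOn_iff]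
  exact continuousOn_id.congr fun x hx => by
    rw [Function.comp_apply, e.toExterior_of_notMem hx]; rfl

end CollaredDisc

/-! ### The two collapses of a connected sum and their partial inverses -/

namespace ConnSum

variable {X : Type*} {Y : Type*} [TopologicalSpace X] [TopologicalSpace Y]
variable (e : CollaredDisc X) (f : CollaredDisc Y)

/-- The quotient map from the disjoint union of the two exteriors. -/
def mk (z : e.Exterior ⊕ f.Exterior) : ConnSum e f := Quot.mk _ z

theorem isQuotientMap_mk : IsQuotientMap (mk e f) := isQuotientMap_quot_mk

theorem continuous_mk : Continuous (mk e f) := (isQuotientMap_mk e f).continuous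

variable {e f} in
theorem ind {P : ConnSum e f → Prop} (hl : ∀ a, P (mk e f (Sum.inl a)))
    (hr : ∀ b, P (mk e f (Sum.inr b))) (z : ConnSum e f) : P z := by
  obtain ⟨z | z, rfl⟩ := (isQuotientMap_mk e f).surjective z
  exacts [hl z, hr z]

/-- The collapse of the second summand. -/
noncomputable def fst : ConnSum e f → X :=
  Quot.lift (Sum.elim (fun a => e.squeeze a.1) fun _ => e.center) (by
    rintro _ _ ⟨a, b, v, hv, ha, hb⟩
    simp only [Sum.elim_inl, Sum.elim_inr, ha, e.squeeze_of_norm_eq_one hv])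

/-- The collapse of the first summand. -/
noncomputable def snd : ConnSum e f → Y :=
  Quot.lift (Sum.elim (fun _ => f.center) fun b => f.squeeze b.1) (by
    rintro _ _ ⟨a, b, v, hv, ha, hb⟩
    simp only [Sum.elim_inl, Sum.elim_inr, hb, f.squeeze_of_norm_eq_one hv])

/-- The inclusion of the complement of the centre of the first disc. -/
noncomputable def inl (x : X) : ConnSum e f := mk e f (Sum.inl (e.toExterior (e.push expandE4 x)))

/-- The inclusion of the complement of the centre of the second disc. -/
noncomputable def inr (y : Y) : ConnSum e f := mk e f (Sum.inr (f.toExterior (f.push expandE4 y)))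

@[simp] theorem fst_mk_inl (a : e.Exterior) : fst e f (mk e f (Sum.inl a)) = e.squeeze a.1 := rfl
@[simp] theorem fst_mk_inr (b : f.Exterior) : fst e f (mk e f (Sum.inr b)) = e.center := rfl
@[simp] theorem snd_mk_inl (a : e.Exterior) : snd e f (mk e f (Sum.inl a)) = f.center := rfl
@[simp] theorem snd_mk_inr (b : f.Exterior) : snd e f (mk e f (Sum.inr b)) = f.squeeze b.1 := rfl

/-- The pair of collapses is the smash map followed by the inclusion of the wedge in the product, so
it lands in the two axes. -/
theorem fst_eq_or_snd_eq (z : ConnSum e f) : fst e f z = e.center ∨ snd e f z = f.center := by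
  induction z using ind with
  | hl a => exact Or.inr rfl
  | hr b => exact Or.inl rfl

theorem continuous_fst [T2Space X] : Continuous (fst e f) := by
  rw [(isQuotientMap_mk e f).continuous_iff]
  exact continuous_sum_dom.2 ⟨e.continuous_squeeze.comp continuous_subtype_val, continuous_const⟩

theorem continuous_snd [T2Space Y] : Continuous (snd e f) := by
  rw [(isQuotientMap_mk e f).continuous_iff]
  exact continuous_sum_dom.2 ⟨continuous_const, f.continuous_squeeze.comp continuous_subtype_val⟩

theorem continuousOn_inl [T2Space X] : ContinuousOn (inl e f) {e.center}ᶜ :=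
  ((continuous_mk e f).comp continuous_inl).comp_continuousOn
    (e.continuousOn_toExterior.comp
      (fun _ hx => (e.continuousAt_push_expandE4 hx).continuousWithinAt)
      fun _ hx h => e.push_expandE4_notMem hx (image_mono Metric.ball_subset_closedBall h))

theorem continuousOn_inr [T2Space Y] : ContinuousOn (inr e f) {f.center}ᶜ :=
  ((continuous_mk e f).comp continuous_inr).comp_continuousOn
    (f.continuousOn_toExterior.comp
      (fun _ hx => (f.continuousAt_push_expandE4 hx).continuousWithinAt)
      fun _ hx h => f.push_expandE4_notMem hx (image_mono Metric.ball_subset_closedBall h))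

theorem fst_inl {x : X} (hx : x ≠ e.center) : fst e f (inl e f x) = x := by
  rw [inl, fst_mk_inl, e.toExterior_of_notMem fun h => e.push_expandE4_notMem hx
    (image_mono Metric.ball_subset_closedBall h)]
  exact e.squeeze_push_expandE4 hx

theorem snd_inr {y : Y} (hy : y ≠ f.center) : snd e f (inr e f y) = y := by
  rw [inr, snd_mk_inr, f.toExterior_of_notMem fun h => f.push_expandE4_notMem hy
    (image_mono Metric.ball_subset_closedBall h)]
  exact f.squeeze_push_expandE4 hy

/-- Off the centre the first collapse is invertible, because `expandE4` undoes `squeezeE4` outside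
the closed unit ball. -/
theorem inl_fst {z : ConnSum e f} (hz : fst e f z ≠ e.center) : inl e f (fst e f z) = z := by
  induction z using ind with
  | hl a =>
    rw [fst_mk_inl] at hz ⊢
    rw [inl, e.push_expandE4_squeeze hz, e.toExterior_val]
  | hr b => exact absurd rfl hz

theorem inr_snd {z : ConnSum e f} (hz : snd e f z ≠ f.center) : inr e f (snd e f z) = z := by
  induction z using ind with
  | hl b => exact absurd rfl hz
  | hr a =>
    rw [snd_mk_inr] at hz ⊢
    rw [inr, f.push_expandE4_squeeze hz, f.toExterior_val]

/-- The preimage of a 1-connected set that misses the centre of the first disc. -/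
theorem oneConnected_fst_preimage [T2Space X] {O : Set X} (hO : OneConnected O)
    (hc : e.center ∉ O) : OneConnected (fst e f ⁻¹' O) := by
  have hne : ∀ x ∈ O, x ≠ e.center := fun x hx h => hc (h ▸ hx)
  exact hO.of_retract ((continuousOn_inl e f).mono hne) (continuous_fst e f).continuousOn
    (fun x hx => by rw [mem_preimage, fst_inl e f (hne x hx)]; exact hx) (fun z hz => hz)
    (fun z hz => inl_fst e f (hne _ hz))

/-- The preimage of a 1-connected set that misses the centre of the second disc. -/
theorem oneConnected_snd_preimage [T2Space Y] {O : Set Y} (hO : OneConnected O)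
    (hc : f.center ∉ O) : OneConnected (snd e f ⁻¹' O) := by
  have hne : ∀ x ∈ O, x ≠ f.center := fun x hx h => hc (h ▸ hx)
  exact hO.of_retract ((continuousOn_inr e f).mono hne) (continuous_snd e f).continuousOn
    (fun x hx => by rw [mem_preimage, snd_inr e f (hne x hx)]; exact hx) (fun z hz => hz)
    (fun z hz => inr_snd e f (hne _ hz))

/-! ### The bicollar of the common sphere -/

/-- Coordinates on the bicollar: the first summand lies outside the unit sphere. -/
noncomputable def collarCoord : ConnSum e f → E4 :=
  Quot.lift (Sum.elim (fun a => e.coord a.1) fun b => reflectE4 (f.coord b.1)) (by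
    rintro _ _ ⟨a, b, v, hv, ha, hb⟩
    simp only [Sum.elim_inl, Sum.elim_inr, ha, hb, CollaredDisc.coord_apply,
      reflectE4_of_norm_eq_one hv])

open Classical in
/-- The point of the bicollar with given coordinates. -/
noncomputable def collarPt (v : E4) : ConnSum e f :=
  if 1 ≤ ‖v‖ then mk e f (Sum.inl (e.toExterior (e.toFun v))) else
    mk e f (Sum.inr (f.toExterior (f.toFun (reflectE4 v))))

/-- The bicollar of size `δ`. -/
def collar (δ : ℝ) : Set (ConnSum e f) :=
  fst e f ⁻¹' (e.toFun '' Metric.ball 0 δ) ∩ snd e f ⁻¹' (f.toFun '' Metric.ball 0 δ)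

/-- On the unit sphere the reflection is the identity and the gluing identifies both descriptions.
The second formula thus holds on a closed set, as pasting requires. -/
theorem collarPt_of_norm_le_one {v : E4} (h1 : ‖v‖ ≤ 1) :
    collarPt e f v = mk e f (Sum.inr (f.toExterior (f.toFun (reflectE4 v)))) := by
  rcases h1.eq_or_lt with h | h
  · rw [collarPt, if_pos h.ge, reflectE4_of_norm_eq_one h]
    refine Quot.sound (CollaredDisc.GlueRel.glue _ _ v h ?_ ?_)
    · rw [e.toExterior_of_notMem (e.notMem_ball h.ge)]
    · rw [f.toExterior_of_notMem (f.notMem_ball h.ge)]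
  · rw [collarPt, if_neg (not_le.2 h)]

theorem isOpen_collar [T2Space X] [T2Space Y] (δ : ℝ) : IsOpen (collar e f δ) :=
  ((e.isOpenEmbedding.isOpenMap _ Metric.isOpen_ball).preimage (continuous_fst e f)).inter
    ((f.isOpenEmbedding.isOpenMap _ Metric.isOpen_ball).preimage (continuous_snd e f))

theorem center_mem_image_ball {X : Type*} [TopologicalSpace X] (e : CollaredDisc X) {δ : ℝ}
    (hδ : 0 < δ) : e.center ∈ e.toFun '' Metric.ball 0 δ := ⟨0, Metric.mem_ball_self hδ, rfl⟩

variable {δ : ℝ}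

theorem exists_of_mem_collar (hδ : δ ≤ 2) {z : ConnSum e f} (hz : z ∈ collar e f δ) :
    ∃ v, 1 ≤ ‖v‖ ∧ ‖v‖ < 1 + δ / 2 ∧ ((∃ a, z = mk e f (Sum.inl a) ∧ a.1 = e.toFun v) ∨
      ∃ b, z = mk e f (Sum.inr b) ∧ b.1 = f.toFun v) := by
  induction z using ind with
  | hl a =>
    obtain ⟨v, hv, h1, h2⟩ := e.exists_of_squeeze_mem a.2 hδ hz.1
    exact ⟨v, h1, h2, Or.inl ⟨a, rfl, hv.symm⟩⟩
  | hr b =>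
    obtain ⟨v, hv, h1, h2⟩ := f.exists_of_squeeze_mem b.2 hδ hz.2
    exact ⟨v, h1, h2, Or.inr ⟨b, rfl, hv.symm⟩⟩

theorem collarCoord_mem (hδ1 : δ ≤ 1) {z : ConnSum e f} (hz : z ∈ collar e f δ) :
    1 - δ / 2 < ‖collarCoord e f z‖ ∧ ‖collarCoord e f z‖ < 1 + δ / 2 := by
  obtain ⟨v, h1, h2, ⟨a, rfl, ha⟩ | ⟨b, rfl, hb⟩⟩ := exists_of_mem_collar e f (by linarith) hz
  · have : collarCoord e f (mk e f (Sum.inl a)) = v := by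
      change e.coord a.1 = v
      rw [ha, e.coord_apply]
    rw [this]
    exact ⟨by linarith, h2⟩
  · have : collarCoord e f (mk e f (Sum.inr b)) = reflectE4 v := by
      change reflectE4 (f.coord b.1) = _
      rw [hb, f.coord_apply]
    rw [this, norm_reflectE4 (norm_pos_iff.1 (by linarith)) (by linarith)]
    constructor <;> linarith

theorem collarPt_collarCoord (hδ1 : δ ≤ 1) {z : ConnSum e f} (hz : z ∈ collar e f δ) :
    collarPt e f (collarCoord e f z) = z := by
  obtain ⟨v, h1, h2, ⟨a, rfl, ha⟩ | ⟨b, rfl, hb⟩⟩ := exists_of_mem_collar e f (by linarith) hz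
  · have : collarCoord e f (mk e f (Sum.inl a)) = v := by
      change e.coord a.1 = v
      rw [ha, e.coord_apply]
    rw [this, collarPt, if_pos h1, ← ha, e.toExterior_val]
  · have : collarCoord e f (mk e f (Sum.inr b)) = reflectE4 v := by
      change reflectE4 (f.coord b.1) = _
      rw [hb, f.coord_apply]
    have hv : v ≠ 0 := norm_pos_iff.1 (by linarith)
    have hn := norm_reflectE4 hv (by linarith)
    rw [this, collarPt_of_norm_le_one e f (by rw [hn]; linarith), reflectE4_reflectE4 hv (by linarith), ← hb, f.toExterior_val]

theorem collarPt_mem (hδ : 0 < δ) (hδ1 : δ ≤ 1) {v : E4} (h1 : 1 - δ / 2 < ‖v‖)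
    (h2 : ‖v‖ < 1 + δ / 2) : collarPt e f v ∈ collar e f δ := by
  have hv : v ≠ 0 := norm_pos_iff.1 (by linarith)
  rcases le_or_gt 1 ‖v‖ with h | h
  · rw [collarPt, if_pos h, e.toExterior_of_notMem (e.notMem_ball h)]
    exact ⟨e.squeeze_mem h (by linarith) h2, center_mem_image_ball f hδ⟩
  · have hn := norm_reflectE4 hv (by linarith)
    rw [collarPt_of_norm_le_one e f h.le,
      f.toExterior_of_notMem (f.notMem_ball (by rw [hn]; linarith))]
    exact ⟨center_mem_image_ball e hδ, f.squeeze_mem (by rw [hn]; linarith) (by linarith)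
      (by rw [hn]; linarith)⟩

theorem continuousOn_collarCoord [T2Space X] [T2Space Y] (hδ1 : δ ≤ 1) :
    ContinuousOn (collarCoord e f) (collar e f δ) := by
  -- As the bicollar is open, continuity may be tested on the disjoint union of the two exteriors.
  rw [(isQuotientMap_mk e f).continuousOn_isOpen_iff (isOpen_collar e f δ)]
  intro z hz
  refine ContinuousAt.continuousWithinAt ?_
  rcases z with a | b
  · obtain ⟨v, hv, -, -⟩ := e.exists_of_squeeze_mem a.2 (by linarith) hz.1
    rw [← IsOpenEmbedding.inl.continuousAt_iff]
    change ContinuousAt (fun a : e.Exterior => e.coord a.1) a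
    refine ContinuousAt.comp ?_ continuous_subtype_val.continuousAt
    rw [← hv]
    exact e.continuousAt_coord v
  · obtain ⟨v, hv, h1, -⟩ := f.exists_of_squeeze_mem b.2 (by linarith) hz.2
    rw [← IsOpenEmbedding.inr.continuousAt_iff]
    change ContinuousAt (fun b : f.Exterior => reflectE4 (f.coord b.1)) b
    have h : ContinuousAt (fun b : f.Exterior => f.coord b.1) b := by
      refine ContinuousAt.comp ?_ continuous_subtype_val.continuousAt
      rw [← hv]
      exact f.continuousAt_coord v
    have hr : ContinuousAt reflectE4 (f.coord b.1) := continuousAt_reflectE4 (by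
      rw [← hv, f.coord_apply]
      exact norm_pos_iff.1 (by linarith))
    exact ContinuousAt.comp (f := fun b : f.Exterior => f.coord b.1) hr h

/-- Two closed pieces are pasted along the unit sphere. The bound `1 / 2` keeps the reflection away
from the origin and still covers all bicollars with `δ ≤ 1`. -/
theorem continuousOn_collarPt : ContinuousOn (collarPt e f) {v | 1 / 2 ≤ ‖v‖ ∧ ‖v‖ < 2} := by
  have c1 : ContinuousOn (collarPt e f) {v | 1 ≤ ‖v‖} := by
    refine ContinuousOn.congr (f := fun v => mk e f (Sum.inl (e.toExterior (e.toFun v)))) ?_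
      fun v hv => if_pos hv
    exact ((continuous_mk e f).comp continuous_inl).comp_continuousOn
      (e.continuousOn_toExterior.comp e.isOpenEmbedding.continuous.continuousOn
        fun v hv => e.notMem_ball hv)
  have ne : ∀ v : E4, 1 / 2 ≤ ‖v‖ → v ≠ 0 := fun v hv => norm_pos_iff.1 (by linarith)
  have c2 : ContinuousOn (collarPt e f) {v | 1 / 2 ≤ ‖v‖ ∧ ‖v‖ ≤ 1} := by
    refine ContinuousOn.congr
      (f := fun v => mk e f (Sum.inr (f.toExterior (f.toFun (reflectE4 v))))) ?_
      fun v hv => collarPt_of_norm_le_one e f hv.2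
    refine ((continuous_mk e f).comp continuous_inr).comp_continuousOn
      (f.continuousOn_toExterior.comp (f.isOpenEmbedding.continuous.comp_continuousOn
        fun v hv => (continuousAt_reflectE4 (ne v hv.1)).continuousWithinAt)
        fun v hv => f.notMem_ball ?_)
    rw [norm_reflectE4 (ne v hv.1) (by linarith [hv.2])]
    linarith [hv.2]
  refine (c1.union_of_isClosed c2 (isClosed_le continuous_const continuous_norm)
    ((isClosed_le continuous_const continuous_norm).inter
      (isClosed_le continuous_norm continuous_const))).mono fun v hv => ?_
  rcases le_total 1 ‖v‖ with h | h
  · exact Or.inl h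
  · exact Or.inr ⟨hv.1, h⟩

theorem oneConnected_collar [T2Space X] [T2Space Y] (hδ : 0 < δ) (hδ1 : δ ≤ 1) :
    OneConnected (collar e f δ) :=
  (oneConnected_shell (a := 1 - δ / 2) (b := 1 + δ / 2) (by linarith) (by linarith)).of_retract
    ((continuousOn_collarPt e f).mono fun v hv => ⟨by linarith [hv.1], by linarith [hv.2]⟩)
    (continuousOn_collarCoord e f hδ1) (fun v hv => collarPt_mem e f hδ hδ1 hv.1 hv.2)
    (fun z hz => collarCoord_mem e f hδ1 hz) (fun z hz => collarPt_collarCoord e f hδ1 hz)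

/-- Distinct points that neither collapse separates both lie over the two centres, hence in the
bicollar, where the collar coordinates separate them. -/
instance [T2Space X] [T2Space Y] : T2Space (ConnSum e f) := by
  refine ⟨fun z z' hne => ?_⟩
  by_cases h1 : fst e f z = fst e f z'
  swap; · exact separated_by_continuous (continuous_fst e f) h1
  by_cases h2 : snd e f z = snd e f z'
  swap; · exact separated_by_continuous (continuous_snd e f) h2
  have k1 : fst e f z = e.center := by
    by_contra h
    exact hne (by rw [← inl_fst e f h, h1, inl_fst e f (h1 ▸ h)])
  have k2 : snd e f z = f.center := by
    by_contra h
    exact hne (by rw [← inr_snd e f h, h2, inr_snd e f (h2 ▸ h)])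
  have c : z ∈ collar e f 1 := ⟨by rw [mem_preimage, k1]; exact center_mem_image_ball e one_pos,
    by rw [mem_preimage, k2]; exact center_mem_image_ball f one_pos⟩
  have c' : z' ∈ collar e f 1 :=
    ⟨by rw [mem_preimage, ← h1, k1]; exact center_mem_image_ball e one_pos,
      by rw [mem_preimage, ← h2, k2]; exact center_mem_image_ball f one_pos⟩
  have hk : collarCoord e f z ≠ collarCoord e f z' := fun h => hne (by
    rw [← collarPt_collarCoord e f le_rfl c, h, collarPt_collarCoord e f le_rfl c'])
  obtain ⟨U, V, oU, oV, hU, hV, hd⟩ := t2_separation hk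
  have cc := continuousOn_collarCoord e f (le_refl (1 : ℝ))
  exact ⟨_, _, cc.isOpen_inter_preimage (isOpen_collar e f 1) oU,
    cc.isOpen_inter_preimage (isOpen_collar e f 1) oV, ⟨c, hU⟩, ⟨c', hV⟩,
    (hd.preimage (collarCoord e f)).mono inter_subset_right inter_subset_right⟩

end ConnSum

/-! ### Small preimages in connected sums -/

theorem CollaredDisc.exists_ball_subset {X : Type*} [TopologicalSpace X] (e : CollaredDisc X)
    {O : Set X} (oO : IsOpen O) (eO : e.center ∈ O) : ∃ δ > 0, e.toFun '' Metric.ball 0 δ ⊆ O := by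
  obtain ⟨δ, hδ, h⟩ := Metric.isOpen_iff.1 (oO.preimage e.isOpenEmbedding.continuous) 0 eO
  exact ⟨δ, hδ, image_subset_iff.2 h⟩

theorem CollaredDisc.oneConnected_punctured {X : Type*} [TopologicalSpace X] (e : CollaredDisc X)
    {δ : ℝ} (hδ : 0 < δ) : OneConnected (e.toFun '' Metric.ball 0 δ \ {e.center}) := by
  refine (oneConnected_shell le_rfl hδ).of_retract (j := e.toFun) (k := e.coord)
    e.isOpenEmbedding.continuous.continuousOn ?_ ?_ ?_ ?_
  · rintro _ ⟨⟨v, -, rfl⟩, -⟩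
    exact (e.continuousAt_coord v).continuousWithinAt
  · intro v hv
    refine ⟨⟨v, mem_ball_zero_iff.2 hv.2, rfl⟩, fun h => ?_⟩
    exact (norm_pos_iff.1 hv.1) (e.injective h)
  · rintro _ ⟨⟨v, hv, rfl⟩, hc⟩
    rw [e.coord_apply]
    exact ⟨norm_pos_iff.2 fun h => hc (by rw [h]; rfl), mem_ball_zero_iff.1 hv⟩
  · rintro _ ⟨⟨v, hv, rfl⟩, hc⟩
    rw [e.coord_apply]

namespace ConnSum

variable {X Y A B : Type*} [TopologicalSpace X] [TopologicalSpace Y] [T2Space X] [T2Space Y]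
variable (e : CollaredDisc X) (f : CollaredDisc Y)

/-- The preimage of the union of two 1-connected open sets that contain the centres. -/
theorem oneConnected_preimage {O : Set X} {P : Set Y} (hO : OneConnected O) (hP : OneConnected P)
    (oO : IsOpen O) (oP : IsOpen P) (eO : e.center ∈ O) (fP : f.center ∈ P) :
    OneConnected (fst e f ⁻¹' O ∩ snd e f ⁻¹' P) := by
  obtain ⟨δ₁, hδ₁, s₁⟩ := e.exists_ball_subset oO eO
  obtain ⟨δ₂, hδ₂, s₂⟩ := f.exists_ball_subset oP fP
  obtain ⟨δ, hδ, d1, d2, d3⟩ : ∃ δ > 0, δ ≤ δ₁ ∧ δ ≤ δ₂ ∧ δ ≤ 1 :=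
    ⟨min δ₁ (min δ₂ 1), by positivity, min_le_left _ _,
      (min_le_right _ _).trans (min_le_left _ _), (min_le_right _ _).trans (min_le_right _ _)⟩
  replace s₁ := (image_mono (Metric.ball_subset_ball d1)).trans s₁
  replace s₂ := (image_mono (Metric.ball_subset_ball d2)).trans s₂
  have oe : IsOpen (e.toFun '' Metric.ball 0 δ) := e.isOpenEmbedding.isOpenMap _ Metric.isOpen_ball
  have of : IsOpen (f.toFun '' Metric.ball 0 δ) := f.isOpenEmbedding.isOpenMap _ Metric.isOpen_ball
  have ce := center_mem_image_ball e hδ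
  have cf := center_mem_image_ball f hδ
  have hA := oneConnected_fst_preimage e f
    (hO.diff_singleton oe ce s₁ (e.oneConnected_punctured hδ)) fun h => h.2 rfl
  have hD := oneConnected_snd_preimage e f
    (hP.diff_singleton of cf s₂ (f.oneConnected_punctured hδ)) fun h => h.2 rfl
  have oA : IsOpen (fst e f ⁻¹' (O \ {e.center})) :=
    (oO.sdiff isClosed_singleton).preimage (continuous_fst e f)
  have oD : IsOpen (snd e f ⁻¹' (P \ {f.center})) :=
    (oP.sdiff isClosed_singleton).preimage (continuous_snd e f)
  have hC := oneConnected_collar e f hδ d3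
  have oC := isOpen_collar e f δ
  have hor := fst_eq_or_snd_eq e f
  -- The bicollar meets the first punctured piece in a copy of a punctured ball, which is path
  -- connected.
  have eAC : fst e f ⁻¹' (O \ {e.center}) ∩ collar e f δ =
      fst e f ⁻¹' (e.toFun '' Metric.ball 0 δ \ {e.center}) := by
    ext z
    constructor
    · rintro ⟨h1, h2⟩
      exact ⟨h2.1, h1.2⟩
    · rintro ⟨h1, h2⟩
      refine ⟨⟨s₁ h1, h2⟩, h1, ?_⟩
      rw [mem_preimage, (hor z).resolve_left h2]
      exact cf
  -- The two punctured pieces are disjoint, so the second meets the union only in its side of the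
  -- bicollar.
  have eACD : (fst e f ⁻¹' (O \ {e.center}) ∪ collar e f δ) ∩ snd e f ⁻¹' (P \ {f.center}) =
      snd e f ⁻¹' (f.toFun '' Metric.ball 0 δ \ {f.center}) := by
    ext z
    constructor
    · rintro ⟨h1 | h1, h2⟩
      · exact ((hor z).elim h1.2 h2.2).elim
      · exact ⟨h1.2, h2.2⟩
    · rintro ⟨h1, h2⟩
      refine ⟨Or.inr ⟨?_, h1⟩, s₂ h1, h2⟩
      rw [mem_preimage, (hor z).resolve_right h2]
      exact ce
  have hAC := hA.union hC oA oC (by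
    rw [eAC]
    exact (oneConnected_fst_preimage e f (e.oneConnected_punctured hδ) fun h => h.2 rfl).1)
  have hACD := hAC.union hD (oA.union oC) oD (by
    rw [eACD]
    exact (oneConnected_snd_preimage e f (f.oneConnected_punctured hδ) fun h => h.2 rfl).1)
  convert hACD using 1
  ext z
  constructor
  · rintro ⟨h1, h2⟩
    by_cases k1 : fst e f z = e.center
    · by_cases k2 : snd e f z = f.center
      · exact Or.inl (Or.inr ⟨by rw [mem_preimage, k1]; exact ce, by rw [mem_preimage, k2]; exact cf⟩)
      · exact Or.inr ⟨h2, k2⟩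
    · exact Or.inl (Or.inl ⟨h1, k1⟩)
  · rintro ((h | h) | h)
    · refine ⟨h.1, ?_⟩
      rw [mem_preimage, (hor z).resolve_left h.2]
      exact fP
    · exact ⟨s₁ h.1, s₂ h.2⟩
    · refine ⟨?_, h.1⟩
      rw [mem_preimage, (hor z).resolve_right h.2]
      exact eO

variable [TopologicalSpace A] [TopologicalSpace B] [T1Space A] [T1Space B]

/-- Over the axes through the images of the centres, the map of a connected sum to a product has
1-connected preimages of small neighbourhoods. -/
theorem oneConnectedOver_prod {c : X → B} {g : Y → A} (cc : Continuous c) (cg : Continuous g)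
    (hc : ∀ b, OneConnectedOver c b) (hg : ∀ a, OneConnectedOver g a) {b : B} {a : A}
    (hba : b = c e.center ∨ a = g f.center) :
    OneConnectedOver (fun z => (c (fst e f z), g (snd e f z))) (b, a) := by
  intro V hV
  obtain ⟨V₁, hV₁, V₂, hV₂, hsub⟩ := mem_nhds_prod_iff.1 hV
  have hor := fst_eq_or_snd_eq e f
  by_cases hb : b = c e.center
  · by_cases ha : a = g f.center
    · obtain ⟨U₁, o₁, m₁, s₁, h₁⟩ := hc b V₁ hV₁
      obtain ⟨U₂, o₂, m₂, s₂, h₂⟩ := hg a V₂ hV₂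
      refine ⟨U₁ ×ˢ U₂, o₁.prod o₂, ⟨m₁, m₂⟩, (Set.prod_mono s₁ s₂).trans hsub, ?_⟩
      exact oneConnected_preimage e f h₁ h₂ (o₁.preimage cc) (o₂.preimage cg)
        (by rw [mem_preimage, ← hb]; exact m₁) (by rw [mem_preimage, ← ha]; exact m₂)
    -- Away from the wedge point, shrinking `U` to avoid the image of the centre forces the other
    -- collapse to its centre. The other coordinate is then automatically right, and the preimage
    -- lies in one summand.
    · obtain ⟨U, oU, mU, sU, hU⟩ := hg a (V₂ ∩ {g f.center}ᶜ)
        (inter_mem hV₂ (isOpen_compl_singleton.mem_nhds ha))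
      refine ⟨interior V₁ ×ˢ U, isOpen_interior.prod oU, ⟨mem_interior_iff_mem_nhds.2 hV₁, mU⟩,
        (Set.prod_mono interior_subset (sU.trans inter_subset_left)).trans hsub, ?_⟩
      convert oneConnected_snd_preimage e f hU (fun h => (sU h).2 rfl) using 1
      ext z
      refine ⟨fun h => h.2, fun h => ⟨?_, h⟩⟩
      have h1 : snd e f z ≠ f.center := fun h' => (sU h).2 (by rw [h']; rfl)
      simp only [(hor z).resolve_right h1, ← hb]
      exact mem_interior_iff_mem_nhds.2 hV₁
  · have ha := hba.resolve_left hb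
    obtain ⟨U, oU, mU, sU, hU⟩ := hc b (V₁ ∩ {c e.center}ᶜ)
      (inter_mem hV₁ (isOpen_compl_singleton.mem_nhds hb))
    refine ⟨U ×ˢ interior V₂, oU.prod isOpen_interior, ⟨mU, mem_interior_iff_mem_nhds.2 hV₂⟩,
      (Set.prod_mono (sU.trans inter_subset_left) interior_subset).trans hsub, ?_⟩
    convert oneConnected_fst_preimage e f hU (fun h => (sU h).2 rfl) using 1
    ext z
    refine ⟨fun h => h.1, fun h => ⟨h, ?_⟩⟩
    have h1 : fst e f z ≠ e.center := fun h' => (sU h).2 (by rw [h']; rfl)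
    simp only [(hor z).resolve_left h1, ← ha]
    exact mem_interior_iff_mem_nhds.2 hV₂

end ConnSum

/-! ### Wedges inside products, and arcs in the circle -/

theorem Topology.IsInducing.oneConnectedOver {Z W P : Type*} [TopologicalSpace Z]
    [TopologicalSpace W] [TopologicalSpace P] {ι : W → P} (hι : IsInducing ι) {q : Z → W} {w : W}
    (h : OneConnectedOver (ι ∘ q) (ι w)) : OneConnectedOver q w := by
  intro V hV
  rw [hι.nhds_eq_comap, mem_comap] at hV
  obtain ⟨V', hV', hsub⟩ := hV
  obtain ⟨U, oU, mU, sU, hU⟩ := h V' hV'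
  exact ⟨ι ⁻¹' U, oU.preimage hι.continuous, mU, (preimage_mono sU).trans hsub, hU⟩

namespace Wedge

variable {B A : Type*} {b₀ : B} {a₀ : A}

/-- The inclusion of a wedge in the product. -/
def toProd : Wedge b₀ a₀ → B × A :=
  Quot.lift (Sum.elim (fun b => (b, a₀)) fun a => (b₀, a)) (by
    rintro _ _ ⟨⟩
    rfl)

theorem toProd_injective : Function.Injective (toProd (b₀ := b₀) (a₀ := a₀)) := by
  have key : ∀ b a, (b, a₀) = (b₀, a) → inl b₀ a₀ b = inr b₀ a₀ a := by
    rintro b a h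
    obtain ⟨rfl, rfl⟩ := Prod.mk.inj h
    exact glue _ _
  rintro ⟨b | a⟩ ⟨b' | a'⟩ h
  · exact congrArg (inl b₀ a₀) (Prod.mk.inj h).1
  · exact key b a' h
  · exact (key b' a h.symm).symm
  · exact congrArg (inr b₀ a₀) (Prod.mk.inj h).2

theorem toProd_mem (w : Wedge b₀ a₀) : (toProd w).1 = b₀ ∨ (toProd w).2 = a₀ := by
  obtain ⟨b | a⟩ := w
  exacts [Or.inr rfl, Or.inl rfl]

variable [TopologicalSpace B] [TopologicalSpace A]

theorem continuous_toProd : Continuous (toProd (b₀ := b₀) (a₀ := a₀)) :=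
  continuous_quot_lift _ (continuous_sum_dom.2 ⟨by fun_prop, by fun_prop⟩)

instance [CompactSpace B] [CompactSpace A] : CompactSpace (Wedge b₀ a₀) :=
  inferInstanceAs (CompactSpace (Quot (WedgeRel b₀ a₀)))

/-- A continuous injection from a compact space to a Hausdorff space is an embedding. It carries
both metrizability and small neighbourhoods from the product to the wedge. -/
theorem isEmbedding_toProd [CompactSpace B] [CompactSpace A] [T2Space B] [T2Space A] :
    IsEmbedding (toProd (b₀ := b₀) (a₀ := a₀)) :=
  (continuous_toProd.isClosedEmbedding toProd_injective).isEmbedding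

end Wedge

/-- The exponential maps a short interval homeomorphically to an open arc, whose preimage is that
arc times the 1-connected 3-sphere. -/
theorem oneConnectedOver_fst_circle (z : Circle) : OneConnectedOver (Prod.fst : S1xS3 → Circle) z := by
  intro V hV
  obtain ⟨t, rfl⟩ := Circle.exp_surjective z
  obtain ⟨h, ht, he⟩ := isLocalHomeomorph_circleExp t
  have hV' : Circle.exp ⁻¹' V ∈ 𝓝 t := Circle.exp.continuous.continuousAt hV
  obtain ⟨ε, hε, hb⟩ := Metric.mem_nhds_iff.1 (inter_mem (h.open_source.mem_nhds ht) hV')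
  have hsrc : Metric.ball t ε ⊆ h.source := fun x hx => (hb hx).1
  refine ⟨h '' Metric.ball t ε, h.isOpen_image_of_subset_source Metric.isOpen_ball hsrc,
    ⟨t, Metric.mem_ball_self hε, by rw [he]⟩, ?_, ?_⟩
  · rintro _ ⟨x, hx, rfl⟩
    rw [← he]
    exact (hb hx).2
  · have harc : OneConnected (h '' Metric.ball t ε) := by
      refine ((convex_ball t ε).oneConnected ⟨t, Metric.mem_ball_self hε⟩).of_retract (j := h)
        (k := h.symm) (h.continuousOn.mono hsrc) (h.continuousOn_symm.mono ?_)
        (mapsTo_image _ _) ?_ ?_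
      · rintro _ ⟨x, hx, rfl⟩
        exact h.map_source (hsrc hx)
      · rintro _ ⟨x, hx, rfl⟩
        rwa [h.left_inv (hsrc hx)]
      · rintro _ ⟨x, hx, rfl⟩
        rw [h.left_inv (hsrc hx)]
    have := harc.prod oneConnected_sphere
    rwa [prod_univ] at this

/-! ### Induction over the summands and the control map -/

namespace SumTower

/-- The properties of the map from the connected sum to the wedge of circles. -/
structure IsControlled (S : SumTower) : Prop where
  t2 : T2Space S.sum
  compact : CompactSpace S.circles
  metrizable : TopologicalSpace.MetrizableSpace S.circles
  continuous : Continuous (S.proj ∘ S.smash)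
  oneConnectedOver : ∀ b, OneConnectedOver (S.proj ∘ S.smash) b

theorem isControlled_one (x : S1xS3) : (one x).IsControlled where
  t2 := inferInstanceAs (T2Space S1xS3)
  compact := inferInstanceAs (CompactSpace Circle)
  metrizable := inferInstanceAs (TopologicalSpace.MetrizableSpace Circle)
  continuous := _root_.continuous_fst (X := Circle) (Y := Metric.sphere (0 : E4) 1)
  oneConnectedOver := oneConnectedOver_fst_circle

/-- In product coordinates the new map is the pair of collapses followed by the old map and the
projection to the circle. By `he` the axes through the images of the centres are exactly the wedge,
so `ConnSum.oneConnectedOver_prod` covers every point of it. -/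
theorem IsControlled.succ {S : SumTower} (hS : S.IsControlled) (e : CollaredDisc S.sum)
    (he : S.smash e.center = S.base) (f : CollaredDisc S1xS3) : (S.succ e he f).IsControlled := by
  have := hS.t2
  have := hS.compact
  have := hS.metrizable
  let ι : Wedge (S.proj S.base) f.center.1 → S.circles × Circle := Wedge.toProd
  have hι : IsEmbedding ι := Wedge.isEmbedding_toProd
  let q : ConnSum e f → Wedge (S.proj S.base) f.center.1 := fun z =>
    Wedge.map S.proj Prod.fst rfl rfl (Wedge.map S.smash id he rfl (ConnSum.smash e f z))
  have key : ι ∘ q = fun z => ((S.proj ∘ S.smash) (ConnSum.fst e f z), (ConnSum.snd e f z).1) := by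
    funext z
    induction z using ConnSum.ind with
    | hl a => rfl
    | hr b =>
      change ((S.proj S.base, (f.squeeze b.1).1) : S.circles × Circle) =
        (S.proj (S.smash e.center), (f.squeeze b.1).1)
      rw [he]
  have cq : Continuous q := by
    rw [hι.isInducing.continuous_iff, key]
    exact (hS.continuous.comp (ConnSum.continuous_fst e f)).prodMk
      (_root_.continuous_fst.comp (ConnSum.continuous_snd e f))
  have oq : ∀ b, OneConnectedOver q b := fun b => hι.isInducing.oneConnectedOver (by
    rw [key]
    refine ConnSum.oneConnectedOver_prod e f (c := S.proj ∘ S.smash) (g := Prod.fst) hS.continuous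
      _root_.continuous_fst hS.oneConnectedOver oneConnectedOver_fst_circle ?_
    rw [Function.comp_apply, he]
    exact Wedge.toProd_mem b)
  exact ⟨inferInstanceAs (T2Space (ConnSum e f)),
    inferInstanceAs (CompactSpace (Wedge (S.proj S.base) f.center.1)), hι.metrizableSpace, cq, oq⟩

theorem IsSumOf.isControlled {r : ℕ} {S : SumTower} (hS : S.IsSumOf r) : S.IsControlled := by
  induction hS with
  | one x => exact isControlled_one x
  | succ _ e he f ih => exact ih.succ e he f

/-- Smashing the connecting sphere and then dropping `M'` is the same as collapsing the second
summand. -/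
theorem controlMap_eq (S : SumTower) {M' : Type*} [TopologicalSpace M'] (e : CollaredDisc S.sum)
    (f : CollaredDisc M') : S.controlMap e f = (S.proj ∘ S.smash) ∘ ConnSum.fst e f := by
  funext z
  induction z using ConnSum.ind <;> rfl

end SumTower

theorem corollary3p4 (r : ℕ) (S : SumTower) (hS : S.IsSumOf r)
    (M' : Type u) [TopologicalSpace M'] [T2Space M'] [ChartedSpace E4 M']
    [SimplyConnectedSpace M']
    (e : CollaredDisc S.sum) (f : CollaredDisc M') :
    CompactSpace S.circles ∧ TopologicalSpace.MetrizableSpace S.circles ∧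
      IsUV1.{w, u, 0} (S.controlMap e f) := by
  have h := hS.isControlled
  have := h.t2
  have := h.compact
  have := h.metrizable
  refine ⟨h.compact, h.metrizable, ?_⟩
  rw [S.controlMap_eq e f]
  refine isUV1_of_oneConnectedOver (h.continuous.comp (ConnSum.continuous_fst e f)) fun b => ?_
  -- Here `M'` plays the second summand with a one-point target: the product is the wedge of circles
  -- itself, and every point lies on the axis through the image of the centre.
  have hι : IsEmbedding (fun b : S.circles => (b, ())) := isEmbedding_prodMkLeft ()
  have hM : ∀ a, OneConnectedOver (fun _ : M' => ()) a := fun a V hV =>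
    ⟨univ, isOpen_univ, mem_univ _, fun x _ => mem_of_mem_nhds (by
      rwa [Subsingleton.elim x a]), OneConnected.univ_of_simplyConnectedSpace M'⟩
  exact hι.isInducing.oneConnectedOver (ConnSum.oneConnectedOver_prod e f h.continuous
    continuous_const h.oneConnectedOver hM (Or.inr rfl))
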